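/- For an integer $c\ge 1$, a finite simple graph is called $c$-closed if any two distinct non-adjacent vertices have at most $c-1$ common neighbors. A maximal induced forest (respectively, a maximal independent set) of a graph $G$ is an inclusion-maximal set $S\subseteq V(G)$ such that the induced subgraph $G[S]$ is a forest, i.e. has no cycle (respectively, has no edge). For an integer $N\ge 0$, let $\mathcal{F}(N)$ be the maximum number of maximal induced forests in a graph on $N$ vertices, and let $\mathcal{M}_0(N)$ be the maximum number of maximal independent sets in a graph on $N$ vertices. Theorem. Let $c\ge 2$ be an integer and let $G$ be a graph on $n\ge 1$ vertices that is the complement of a $c$-closed graph. Then the number of maximal induced forests in $G$ is at most $$ n^3\,\mathcal{M}_0(c-1) + 2n^3 (c-1)\,\mathcal{F}(2c-3) \;\le\; 3\, n^3 (c-1)\cdot 1.8638^{\,2c-3}. $$ -/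

import Mathlib

namespace CClosure

/-- A graph is `c`-closed if any two distinct non-adjacent vertices have at most `c - 1`
(that is, fewer than `c`) common neighbours. -/
def IsCClosed {V : Type*} (G : SimpleGraph V) (c : ℕ) : Prop :=
  ∀ u v : V, u ≠ v → ¬ G.Adj u v → (G.commonNeighbors u v).encard < c

/-- The sets of vertices that induce a maximal induced forest of `G`: the subgraph induced by `S`
is a forest, and no proper superset of `S` induces a forest. -/
def maximalInducedForests {V : Type*} (G : SimpleGraph V) : Set (Set V) :=
  {S | Maximal (fun T : Set V => (G.induce T).IsAcyclic) S}

/-- The sets of vertices that induce a maximal induced subgraph of `G` of maximum degree at most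
`d`; for `d = 0` these are the maximal independent sets. -/
def maximalDegreeAtMost {V : Type*} (d : ℕ) (G : SimpleGraph V) : Set (Set V) :=
  {S | Maximal (fun T : Set V => ∀ v ∈ T, (G.neighborSet v ∩ T).encard ≤ d) S}

open Classical in
/-- `F N`: the maximum number of maximal induced forests in a graph on `N` vertices. -/
noncomputable def F (N : ℕ) : ℕ :=
  Finset.univ.sup fun G : SimpleGraph (Fin N) => (maximalInducedForests G).ncard

open Classical in
/-- `M d N`: the maximum number of maximal induced subgraphs of maximum degree at most `d`
in a graph on `N` vertices. -/
noncomputable def M (d N : ℕ) : ℕ :=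
  Finset.univ.sup fun G : SimpleGraph (Fin N) => (maximalDegreeAtMost d G).ncard

end CClosure

/-! In the complement of a `c`-closed graph, any two adjacent vertices have at most `c - 1` common
non-neighbours; write `N(ab)` for this set of an edge `ab`. An edge thus sees almost the whole
graph, and a forest with two disjoint edges is confined to a small set.

Let `S` be a maximal induced forest. If some vertex `a` of `S` covers all edges of `G[S]`, then `S`
is determined by its trace on the neighbourhood of `a`, which is a maximal independent set there
(`ncard_starForests_le`). Such independent sets are few because each is determined by an edge `uv`
and a maximal independent set of the trace of `N(uv)` (`ncard_maxIndep_le`). Summing over `a` gives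
`n³ M₀(c-1)`.

Otherwise `G[S]` has two disjoint edges, since in a forest pairwise intersecting edges form a star.
Either `S` contains a path `b a l x`, or no vertex of `S` touches both of two edges `ab` and `lx`.
In both cases `S` lies in `N(ab) ∪ N(lx)`, together with the path in the first case. Contracting the
path, or the edge `ab`, turns the forests containing it into maximal forests of a graph on at most
`2c - 3` vertices (`ncard_maxForests_le_F`). Choosing `a, l, x` freely and then `b ∈ N(lx)` costs
`n³ (c-1)` in each case, whence the second summand.

The numerical bound rests on `F N ≤ 1.8638 ^ N` (`F_le`), proved by measure and conquer. A partial
forest `A` with a distinguished component `C` is grown by branching on a vertex adjacent to `C`;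
undecided vertices weigh 5 or 8 according to whether they touch `C`, and each branching rule is
checked against one factor `y` per unit of weight, with `y ^ 8 ≤ 1.8638`. -/

namespace CClosure

open SimpleGraph

/-! ### Induced forests and connection inside a vertex set -/

section Forest

variable {V : Type*} {G : SimpleGraph V} {A B : Set V} {u v w x y z : V}

/-- The set `A` induces a forest of `G`. -/
abbrev Acyc (G : SimpleGraph V) (A : Set V) : Prop := (G.induce A).IsAcyclic

/-- `x` and `y` are joined by a walk of `G` all of whose edges lie inside `A`. -/
def Conn (G : SimpleGraph V) (A : Set V) : V → V → Prop :=
  Relation.ReflTransGen fun p q => G.Adj p q ∧ p ∈ A ∧ q ∈ A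

theorem Conn.refl (x : V) : Conn G A x x := Relation.ReflTransGen.refl

theorem Conn.trans (h : Conn G A x y) (h' : Conn G A y z) : Conn G A x z :=
  Relation.ReflTransGen.trans h h'

theorem Conn.symm (h : Conn G A x y) : Conn G A y x := by
  induction h with
  | refl => exact Conn.refl _
  | tail _ hst ih => exact (Relation.ReflTransGen.single ⟨hst.1.symm, hst.2.2, hst.2.1⟩).trans ih

theorem Conn.single (h : G.Adj x y) (hx : x ∈ A) (hy : y ∈ A) : Conn G A x y :=
  Relation.ReflTransGen.single ⟨h, hx, hy⟩

theorem Conn.mono (hAB : A ⊆ B) (h : Conn G A x y) : Conn G B x y :=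
  Relation.ReflTransGen.mono (fun _ _ h => ⟨h.1, hAB h.2.1, hAB h.2.2⟩) _ _ h

/-- A set closed under adjacency within `A` is closed under connection within `A`. -/
theorem Conn.mem_of_closed (h : Conn G A x y) (hx : x ∈ B)
    (hB : ∀ p ∈ B, ∀ q ∈ A, p ∈ A → G.Adj p q → q ∈ B) : y ∈ B := by
  induction h with
  | refl => exact hx
  | tail _ hst ih => exact hB _ ih _ hst.2.2 hst.2.1 hst.1

/-- A connection in `A` that starts in a subset closed under adjacency stays in that subset. -/
theorem Conn.restrict (h : Conn G A x y) (hx : x ∈ B)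
    (hB : ∀ p ∈ B, ∀ q ∈ A, p ∈ A → G.Adj p q → q ∈ B) : Conn G B x y := by
  induction h with
  | refl => exact Conn.refl _
  | tail h1 hst ih =>
    have hp := Conn.mem_of_closed h1 hx hB
    exact ih.trans (Conn.single hst.1 hp (hB _ hp _ hst.2.2 hst.2.1 hst.1))

theorem Conn.mem_right (h : Conn G A x y) (hx : x ∈ A) : y ∈ A :=
  h.mem_of_closed hx fun _ _ _ hq _ _ => hq

theorem conn_of_walk (p : G.Walk x y) (hp : ∀ z ∈ p.support, z ∈ A) : Conn G A x y := by
  induction p with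
  | nil => exact Conn.refl _
  | cons h p ih =>
    have h2 : ∀ z ∈ p.support, z ∈ A := fun z hz => hp z (by simp [hz])
    exact (Conn.single h (hp _ (by simp)) (h2 _ (by simp))).trans (ih h2)

theorem Conn.exists_walk (h : Conn G A x y) (hx : x ∈ A) :
    ∃ p : G.Walk x y, ∀ z ∈ p.support, z ∈ A := by
  induction h with
  | refl => exact ⟨Walk.nil, by simpa using hx⟩
  | tail _ hst ih =>
    obtain ⟨p, hp⟩ := ih
    refine ⟨p.concat hst.1, fun z hz => ?_⟩
    rw [Walk.support_concat, List.mem_append] at hz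
    rcases hz with hz | hz
    · exact hp z hz
    · rw [List.mem_singleton.1 hz]; exact hst.2.2

theorem acyc_iff_cycle :
    Acyc G A ↔ ∀ (u : V) (c : G.Walk u u), c.IsCycle → ¬ ∀ z ∈ c.support, z ∈ A := by
  constructor
  · intro h u c hc hA
    refine h (c.induce A hA) ?_
    refine Walk.IsCycle.of_map (f := (Embedding.induce A).toHom) ?_
    rw [Walk.map_induce]
    exact hc
  · intro h u c hc
    refine h _ (c.map (Embedding.induce A).toHom) (hc.map Subtype.val_injective) ?_
    intro z hz
    rw [Walk.support_map, List.mem_map] at hz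
    obtain ⟨a, _, rfl⟩ := hz
    exact a.2

theorem Acyc.mono (h : Acyc G B) (hAB : A ⊆ B) : Acyc G A :=
  acyc_iff_cycle.2 fun u c hc hA => acyc_iff_cycle.1 h u c hc fun z hz => hAB (hA z hz)

/-- Adding a vertex to a forest keeps it a forest exactly when the vertex has at most one
neighbour in each component. -/
theorem acyc_insert_iff (hv : v ∉ A) : Acyc G (insert v A) ↔
    Acyc G A ∧ ∀ x ∈ A, ∀ y ∈ A, G.Adj v x → G.Adj v y → Conn G A x y → x = y := by
  classical
  constructor
  · intro h
    refine ⟨h.mono (Set.subset_insert _ _), fun x hx y hy hvx hvy hc => ?_⟩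
    by_contra hne
    obtain ⟨p, hp⟩ := hc.exists_walk hx
    have hsup : ∀ z ∈ p.bypass.support, z ∈ A := fun z hz => hp z (p.support_bypass_subset_support hz)
    have hvs : v ∉ p.bypass.support := fun hh => hv (hsup v hh)
    have hq : (Walk.cons hvx p.bypass).IsPath := by
      rw [Walk.cons_isPath_iff]
      exact ⟨p.bypass_isPath, hvs⟩
    have hcyc : (Walk.cons hvy.symm (Walk.cons hvx p.bypass)).IsCycle := by
      rw [Walk.cons_isCycle_iff]
      refine ⟨hq, ?_⟩
      rw [Walk.edges_cons, List.mem_cons, not_or]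
      constructor
      · intro he
        rw [Sym2.eq_iff] at he
        rcases he with ⟨rfl, _⟩ | ⟨h1, _⟩
        · exact hv hy
        · exact hne h1.symm
      · intro he
        exact hvs (Walk.snd_mem_support_of_mem_edges _ he)
    refine acyc_iff_cycle.1 h _ _ hcyc fun z hz => ?_
    rw [Walk.support_cons, Walk.support_cons, List.mem_cons, List.mem_cons] at hz
    rcases hz with rfl | rfl | hz
    · exact Set.mem_insert_of_mem _ hy
    · exact Set.mem_insert _ _
    · exact Set.mem_insert_of_mem _ (hsup z hz)
  · rintro ⟨h1, h2⟩
    refine acyc_iff_cycle.2 fun u c hc hA => ?_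
    by_cases hvc : v ∈ c.support
    · have hc' := hc.rotate hvc
      have hA' : ∀ z ∈ (c.rotate v hvc).support, z ∈ insert v A := by
        intro z hz
        exact hA z ((Walk.mem_support_rotate_iff c v hvc).1 hz)
      generalize c.rotate v hvc = d at hc' hA'
      cases d with
      | nil => exact Walk.not_isCycle_nil hc'
      | @cons _ x _ h p =>
        rw [Walk.cons_isCycle_iff] at hc'
        obtain ⟨hp, he⟩ := hc'
        have hp' := hp.reverse
        have he' : s(v, x) ∉ p.reverse.edges := by simpa using he
        have hs' : ∀ z ∈ p.reverse.support, z ∈ insert v A := by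
          intro z hz
          rw [Walk.support_reverse, List.mem_reverse] at hz
          exact hA' z (by simp [hz])
        generalize p.reverse = q at hp' he' hs'
        cases q with
        | nil => exact G.loopless.irrefl _ h
        | @cons _ y _ h' q =>
          rw [Walk.cons_isPath_iff] at hp'
          have hq : ∀ z ∈ q.support, z ∈ A := by
            intro z hz
            rcases hs' z (by simp [hz]) with rfl | h3
            · exact absurd hz hp'.2
            · exact h3
          have hxy : y = x := h2 y (hq _ (by simp)) x (hq _ (by simp)) h' h (conn_of_walk q hq)
          subst hxy
          exact he' (by simp)
    · refine acyc_iff_cycle.1 h1 u c hc fun z hz => ?_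
      rcases hA z hz with rfl | h3
      · exact absurd hz hvc
      · exact h3

theorem acyc_empty : Acyc G (∅ : Set V) :=
  acyc_iff_cycle.2 fun u c _ hA => hA u (by simp)

/-- Two neighbours of a vertex outside of a connected part close a cycle. -/
theorem not_acyc_of_conn (hA : A ⊆ B) (hv : v ∈ B) (hvA : v ∉ A) (hx : x ∈ A) (hy : y ∈ A)
    (hxy : x ≠ y) (hvx : G.Adj v x) (hvy : G.Adj v y) (hc : Conn G A x y) : ¬ Acyc G B := by
  intro h
  have h' : Acyc G (insert v A) := h.mono (Set.insert_subset hv hA)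
  exact hxy (((acyc_insert_iff hvA).1 h').2 x hx y hy hvx hvy hc)

end Forest

/-! ### Partial forests and generalised neighbours -/

section Branching

variable {V : Type*} {G : SimpleGraph V} {A X C S : Set V} {v w : V}

/-- The maximal induced forests of `G[X]` that contain `A`. -/
def maxForests (G : SimpleGraph V) (A X : Set V) : Set (Set V) :=
  {S | A ⊆ S ∧ Maximal (fun T => T ⊆ X ∧ Acyc G T) S}

theorem mem_of_acyc_insert (hS : S ∈ maxForests G A X) (hv : v ∈ X)
    (h : Acyc G (insert v S)) : v ∈ S :=
  hS.2.2 ⟨Set.insert_subset hv hS.2.1.1, h⟩ (Set.subset_insert v S) (Set.mem_insert v S)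

theorem maxForests_shrink {Y : Set V} (hYX : Y ⊆ X) (hS : S ∈ maxForests G A X) (hSY : S ⊆ Y) :
    S ∈ maxForests G A Y :=
  ⟨hS.1, ⟨hSY, hS.2.1.2⟩, fun _ hT hST => hS.2.2 ⟨hT.1.trans hYX, hT.2⟩ hST⟩

theorem maxForests_erase (hS : S ∈ maxForests G A X) (hv : v ∉ S) :
    S ∈ maxForests G A (X \ {v}) :=
  maxForests_shrink Set.sdiff_subset hS fun _ hx => ⟨hS.2.1.1 hx, fun h => hv (h ▸ hx)⟩

theorem maxForests_include (hS : S ∈ maxForests G A X) (hv : v ∈ S) :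
    S ∈ maxForests G (insert v A) X :=
  ⟨Set.insert_subset hv hS.1, hS.2⟩

theorem maxForests_sdiff {J : Set V} (hJ : ∀ w ∈ J, ¬ Acyc G (insert w A)) :
    maxForests G A X ⊆ maxForests G A (X \ J) := fun _ hS =>
  maxForests_shrink Set.sdiff_subset hS fun x hx =>
    ⟨hS.2.1.1 hx, fun h => hJ x h (hS.2.1.2.mono (Set.insert_subset hx hS.1))⟩

variable [Finite V]

theorem ncard_maxForests_include_le (T : Set (Set V)) (hT : T ⊆ maxForests G A X)
    (h : ∀ S ∈ T, w ∈ S) : T.ncard ≤ (maxForests G (insert w A) X).ncard :=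
  Set.ncard_le_ncard (fun S hS => maxForests_include (hT hS) (h S hS)) (Set.toFinite _)

theorem ncard_maxForests_split_le (T : Set (Set V)) (hT : T ⊆ maxForests G A X) (w : V) :
    T.ncard ≤ (maxForests G (insert w A) X).ncard + (T ∩ {S | w ∉ S}).ncard ∧
      T ∩ {S | w ∉ S} ⊆ maxForests G A (X \ {w}) := by
  constructor
  · have h : T = (T ∩ {S | w ∈ S}) ∪ (T ∩ {S | w ∉ S}) := by
      ext S
      by_cases hw : w ∈ S <;> simp [hw]
    have h1 := Set.ncard_union_le (T ∩ {S | w ∈ S}) (T ∩ {S | w ∉ S})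
    rw [← h] at h1
    refine h1.trans (Nat.add_le_add_right ?_ _)
    exact ncard_maxForests_include_le _ (fun S hS => hT hS.1) (fun S hS => hS.2)
  · rintro S ⟨hS, hw⟩
    exact maxForests_erase (hT hS) hw

/-- `C` is empty or a component of `G[A]`. -/
structure IsPart (G : SimpleGraph V) (A C : Set V) : Prop where
  subset : C ⊆ A
  closed : ∀ p ∈ C, ∀ q ∈ A, G.Adj p q → q ∈ C
  conn : ∀ p ∈ C, ∀ q ∈ C, Conn G A p q

omit [Finite V] in
theorem isPart_empty : IsPart G A ∅ :=
  ⟨Set.empty_subset _, fun _ h => h.elim, fun _ h => h.elim⟩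

/-- The set of vertices connected to `C` within `A`. -/
def closureIn (G : SimpleGraph V) (A C : Set V) : Set V := {x | ∃ c ∈ C, Conn G A c x}

omit [Finite V] in
theorem subset_closureIn : C ⊆ closureIn G A C := fun c hc => ⟨c, hc, Conn.refl _⟩

omit [Finite V] in
theorem isPart_closureIn (hC : C ⊆ A) (h : ∀ p ∈ C, ∀ q ∈ C, Conn G A p q) :
    IsPart G A (closureIn G A C) where
  subset := by
    rintro x ⟨c, hc, hx⟩
    exact hx.mem_right (hC hc)
  closed := by
    rintro p ⟨c, hc, hp⟩ q hq hpq
    exact ⟨c, hc, hp.trans (Conn.single hpq (hp.mem_right (hC hc)) hq)⟩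
  conn := by
    rintro p ⟨c, hc, hp⟩ q ⟨d, hd, hq⟩
    exact hp.symm.trans ((h c hc d hd).trans hq)

/-- `v` and `w` are adjacent once every component of `G[A]` other than `C` is contracted
into its neighbours. -/
def GAdj (G : SimpleGraph V) (A C : Set V) (v w : V) : Prop :=
  v ≠ w ∧ (G.Adj v w ∨ ∃ x ∈ A \ C, ∃ y ∈ A \ C, G.Adj v x ∧ G.Adj w y ∧ Conn G A x y)

omit [Finite V] in
/-- A vertex left out by a maximal forest has a generalised neighbour in that forest. -/
theorem exists_gAdj (hC : IsPart G A C) (hS : S ∈ maxForests G A X) (hv : v ∈ X) (hvS : v ∉ S)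
    (hac : Acyc G (insert v A)) : ∃ w ∈ S, w ∉ A ∧ GAdj G A C v w := by
  by_contra! hcon
  have hvA : v ∉ A := fun h => hvS (hS.1 h)
  have hA : ∀ x ∈ S, G.Adj v x → x ∈ A := by
    intro x hx hvx
    by_contra hxA
    exact hcon x hx hxA ⟨hvx.ne, Or.inl hvx⟩
  -- A connection in `S` from a neighbour of `v` in `A \ C` cannot leave `A`: the first vertex
  -- outside `A` would be a generalised neighbour of `v`. It cannot enter `C` either, as `C` is
  -- closed in `A`.
  have key : ∀ x ∈ A \ C, ∀ y, G.Adj v x → Conn G S x y → Conn G A x y := by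
    intro x hx y hvx hxy
    have hxD : x ∈ {p | p ∈ A \ C ∧ Conn G A x p} := ⟨hx, Conn.refl _⟩
    refine (hxy.restrict hxD ?_).mono fun p hp => hp.1.1
    rintro p ⟨hp, hxp⟩ q hq _ hpq
    have hqA : q ∈ A := by
      by_contra hqA
      refine hcon q hq hqA ⟨fun h => hvS (h ▸ hq), Or.inr ⟨x, hx, p, hp, hvx, hpq.symm, hxp⟩⟩
    exact ⟨⟨hqA, fun hqC => hp.2 (hC.closed q hqC p hp.1 hpq.symm)⟩,
      hxp.trans (Conn.single hpq hp.1 hqA)⟩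
  refine hvS (mem_of_acyc_insert hS hv ((acyc_insert_iff hvS).2 ⟨hS.2.1.2, ?_⟩))
  intro x hx y hy hvx hvy hxy
  have hxA := hA x hx hvx
  have hyA := hA y hy hvy
  refine ((acyc_insert_iff hvA).1 hac).2 x hxA y hyA hvx hvy ?_
  by_cases hxC : x ∈ C
  · by_cases hyC : y ∈ C
    · exact hC.conn x hxC y hyC
    · exact (key y ⟨hyA, hyC⟩ x hvy hxy.symm).symm
  · exact key x ⟨hxA, hxC⟩ y hvx hxy

omit [Finite V] in
/-- Two generalised neighbours that are both adjacent to `C` close a cycle. -/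
theorem not_acyc_of_gAdj (hC : IsPart G A C) (hvA : v ∉ A) (hwA : w ∉ A)
    (hv : ∃ c ∈ C, G.Adj v c) (hw : ∃ c ∈ C, G.Adj w c) (h : GAdj G A C v w) :
    ¬ Acyc G (insert w (insert v A)) := by
  obtain ⟨c, hc, hvc⟩ := hv
  obtain ⟨d, hd, hwd⟩ := hw
  have hsub : A ⊆ insert v A := Set.subset_insert v A
  have hwv : w ∉ insert v A := by
    rintro (rfl | h')
    · exact h.1 rfl
    · exact hwA h'
  have hvd : Conn G (insert v A) v d :=
    (Conn.single hvc (Set.mem_insert _ _) (hsub (hC.subset hc))).trans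
      ((hC.conn c hc d hd).mono hsub)
  rcases h.2 with hvw | ⟨x, hx, y, hy, hvx, hwy, hxy⟩
  · exact not_acyc_of_conn (Set.subset_insert _ _) (Set.mem_insert _ _) hwv (Set.mem_insert _ _)
      (hsub (hC.subset hd)) (fun hvd => hvA (hvd ▸ hC.subset hd)) hvw.symm hwd hvd
  · refine not_acyc_of_conn (Set.subset_insert _ _) (Set.mem_insert _ _) hwv (hsub hy.1)
      (hsub (hC.subset hd)) (fun hyd => hy.2 (hyd ▸ hd)) hwy hwd ?_
    exact (hxy.symm.mono hsub).trans
      ((Conn.single hvx.symm (hsub hx.1) (Set.mem_insert _ _)).trans hvd)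

omit [Finite V] in
theorem adj_closureIn_of_gAdj (h : GAdj G A C v w) :
    ∃ c ∈ closureIn G (insert v A) (insert v C), G.Adj w c := by
  rcases h.2 with hvw | ⟨x, hx, y, hy, hvx, hwy, hxy⟩
  · exact ⟨v, subset_closureIn (Set.mem_insert _ _), hvw.symm⟩
  · refine ⟨y, ⟨v, Set.mem_insert _ _, ?_⟩, hwy⟩
    exact (Conn.single hvx (Set.mem_insert _ _) (Set.mem_insert_of_mem _ hx.1)).trans
      (hxy.mono (Set.subset_insert _ _))

end Branching

/-! ### The weighted measure of a state -/

section Measure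

variable {V : Type*} {G : SimpleGraph V} {A X C : Set V} {v w : V}

open Classical in
/-- The weight of an undecided vertex: `5` if it is adjacent to `C` and `8` otherwise. -/
noncomputable def weight (G : SimpleGraph V) (A X C : Set V) (w : V) : ℕ :=
  if w ∈ X ∧ w ∉ A then (if ∃ c ∈ C, G.Adj w c then 5 else 8) else 0

theorem weight_adj (hX : w ∈ X) (hA : w ∉ A) (h : ∃ c ∈ C, G.Adj w c) : weight G A X C w = 5 := by
  simp only [weight, if_pos (And.intro hX hA), if_pos h]

theorem weight_not_adj (hX : w ∈ X) (hA : w ∉ A) (h : ¬ ∃ c ∈ C, G.Adj w c) :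
    weight G A X C w = 8 := by
  simp only [weight, if_pos (And.intro hX hA), if_neg h]

theorem weight_eq_zero (h : ¬ (w ∈ X ∧ w ∉ A)) : weight G A X C w = 0 := by
  simp only [weight, if_neg h]

theorem five_le_weight (hX : w ∈ X) (hA : w ∉ A) : 5 ≤ weight G A X C w := by
  by_cases h : ∃ c ∈ C, G.Adj w c
  · rw [weight_adj hX hA h]
  · rw [weight_not_adj hX hA h]; norm_num

theorem weight_le_five (h : ∃ c ∈ C, G.Adj w c) : weight G A X C w ≤ 5 := by
  by_cases hw : w ∈ X ∧ w ∉ A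
  · rw [weight_adj hw.1 hw.2 h]
  · rw [weight_eq_zero hw]; norm_num

theorem weight_mono {A' X' C' : Set V} (hA : A ⊆ A') (hX : X' ⊆ X) (hC : C ⊆ C') (w : V) :
    weight G A' X' C' w ≤ weight G A X C w := by
  by_cases hw : w ∈ X' ∧ w ∉ A'
  · have hw' : w ∈ X ∧ w ∉ A := ⟨hX hw.1, fun h => hw.2 (hA h)⟩
    by_cases h : ∃ c ∈ C, G.Adj w c
    · obtain ⟨c, hc, hwc⟩ := h
      rw [weight_adj hw.1 hw.2 ⟨c, hC hc, hwc⟩, weight_adj hw'.1 hw'.2 ⟨c, hc, hwc⟩]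
    · rw [weight_not_adj hw'.1 hw'.2 h]
      by_cases h' : ∃ c ∈ C', G.Adj w c
      · rw [weight_adj hw.1 hw.2 h']; norm_num
      · rw [weight_not_adj hw.1 hw.2 h']
  · rw [weight_eq_zero hw]; exact Nat.zero_le _

variable [Fintype V]

/-- The total weight of the undecided vertices. -/
noncomputable def measure (G : SimpleGraph V) (A X C : Set V) : ℕ := ∑ w, weight G A X C w

theorem measure_add_le {A' X' C' : Set V} (d : V → ℕ)
    (h : ∀ w, weight G A' X' C' w + d w ≤ weight G A X C w) :
    measure G A' X' C' + ∑ w, d w ≤ measure G A X C := by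
  rw [measure, ← Finset.sum_add_distrib]
  exact Finset.sum_le_sum fun w _ => h w

theorem measure_add_weight_le {A' X' C' : Set V} (hA : A ⊆ A') (hX : X' ⊆ X) (hC : C ⊆ C')
    (hw : ¬ (w ∈ X' ∧ w ∉ A')) :
    measure G A' X' C' + weight G A X C w ≤ measure G A X C := by
  classical
  have h := measure_add_le (G := G) (A' := A') (X' := X') (C' := C') (A := A) (X := X) (C := C)
    (fun x => if x = w then weight G A X C w else 0) ?_
  · simpa using h
  · intro x
    by_cases hx : x = w
    · subst hx
      simp [weight_eq_zero hw]
    · simpa [hx] using weight_mono hA hX hC x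

/-- The gain in measure when `v` joins the forest, the vertices of `J` are thereby excluded and the
vertices of `K` become adjacent to the distinguished component. -/
theorem measure_include_le (J K : Finset V) (hvX : v ∈ X) (hvA : v ∉ A)
    (hJ : ∀ w ∈ J, w ∈ X ∧ w ∉ A ∧ (∃ c ∈ C, G.Adj w c) ∧ w ≠ v)
    (hK : ∀ w ∈ K, w ∈ X ∧ w ∉ A ∧ (¬ ∃ c ∈ C, G.Adj w c) ∧ GAdj G A C v w) :
    measure G (insert v A) (X \ J) (closureIn G (insert v A) (insert v C)) +
      (weight G A X C v + 5 * J.card + 3 * K.card) ≤ measure G A X C := by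
  classical
  have h := measure_add_le (G := G) (A' := insert v A) (X' := X \ J)
    (C' := closureIn G (insert v A) (insert v C)) (A := A) (X := X) (C := C)
    (fun x => (if x = v then weight G A X C v else 0) + ((if x ∈ J then 5 else 0) +
      (if x ∈ K then 3 else 0))) ?_
  · rw [Finset.sum_add_distrib, Finset.sum_add_distrib, Finset.sum_ite_eq' Finset.univ v,
      Finset.sum_ite_mem, Finset.sum_ite_mem, Finset.univ_inter, Finset.univ_inter,
      Finset.sum_const, Finset.sum_const] at h
    simp only [Finset.mem_univ, if_true, smul_eq_mul] at h
    omega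
  · intro x
    by_cases hxJ : x ∈ J
    · obtain ⟨h1, h2, h3, h4⟩ := hJ x hxJ
      have hxK : x ∉ K := fun hxK => (hK x hxK).2.2.1 h3
      have h0 : weight G (insert v A) (X \ J) (closureIn G (insert v A) (insert v C)) x = 0 :=
        weight_eq_zero fun hh => hh.1.2 hxJ
      simp only [h0, h4, hxJ, hxK, if_true, if_false, weight_adj h1 h2 h3]
      norm_num
    · by_cases hxK : x ∈ K
      · obtain ⟨h1, h2, h3, h4⟩ := hK x hxK
        have h5 := weight_le_five (G := G) (A := insert v A) (X := X \ (J : Set V))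
          (adj_closureIn_of_gAdj h4)
        simp only [h4.1.symm, hxJ, hxK, if_true, if_false, weight_not_adj h1 h2 h3]
        omega
      · by_cases hxv : x = v
        · subst hxv
          have h0 : weight G (insert x A) (X \ J) (closureIn G (insert x A) (insert x C)) x = 0 :=
            weight_eq_zero fun hh => hh.2 (Set.mem_insert _ _)
          simp only [h0, hxJ, hxK, if_true, if_false]
          omega
        · simp only [hxv, hxJ, hxK, if_false, add_zero]
          exact weight_mono (Set.subset_insert _ _) Set.sdiff_subset
            ((Set.subset_insert _ _).trans subset_closureIn) x

end Measure

/-! ### Branching inequalities and the bound on `F` -/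

section Count

variable {V : Type*} [Fintype V] {G : SimpleGraph V} {A X C : Set V} {v w : V}

/-- The bound `y ^ measure` for all states of measure less than `m`. -/
def BoundBelow (G : SimpleGraph V) (y : ℝ) (m : ℕ) : Prop :=
  ∀ A X C : Set V, IsPart G A C → measure G A X C < m →
    ((maxForests G A X).ncard : ℝ) ≤ y ^ measure G A X C

variable {y : ℝ} {m r g : ℕ}

theorem BoundBelow.le (h : BoundBelow G y m) (hy : 1 ≤ y) (hC : IsPart G A C)
    (hg : 0 < g) (hm : measure G A X C + g ≤ m) :
    ((maxForests G A X).ncard : ℝ) ≤ y⁻¹ ^ g * y ^ m := by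
  have hy0 : (0 : ℝ) < y := by linarith
  refine (h A X C hC (by omega)).trans ?_
  calc y ^ measure G A X C ≤ y ^ (m - g) := pow_le_pow_right₀ hy (by omega)
    _ = y⁻¹ ^ g * y ^ m := by
      obtain ⟨k, rfl⟩ : ∃ k, m = g + k := ⟨m - g, by omega⟩
      rw [pow_add, ← mul_assoc, ← mul_pow, inv_mul_cancel₀ hy0.ne', one_pow, one_mul,
        Nat.add_sub_cancel_left]

theorem BoundBelow.include_le (h : BoundBelow G y m) (hy : 1 ≤ y) (hC : IsPart G A C)
    (hwX : w ∈ X) (hwA : w ∉ A) (hm : measure G A X C + r ≤ m) :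
    ((maxForests G (insert w A) X).ncard : ℝ) ≤ y⁻¹ ^ (r + weight G A X C w) * y ^ m := by
  have hsub : A ⊆ insert w A := Set.subset_insert _ _
  have h1 := measure_add_weight_le (G := G) (A := A) (X := X) (C := C) (A' := insert w A) (X' := X)
    (C' := closureIn G (insert w A) C) (w := w) hsub subset_rfl subset_closureIn
    (fun hh => hh.2 (Set.mem_insert _ _))
  refine h.le hy (isPart_closureIn (hC.subset.trans hsub)
    fun p hp q hq => (hC.conn p hp q hq).mono hsub) ?_ ?_
  · have := five_le_weight (G := G) (C := C) hwX hwA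
    omega
  · omega

/-- Branching on a vertex `w` for a family of maximal forests. -/
theorem BoundBelow.family_le (h : BoundBelow G y m) (hy : 1 ≤ y) (hC : IsPart G A C)
    {T : Set (Set V)} (hT : T ⊆ maxForests G A X) (hwX : w ∈ X) (hwA : w ∉ A)
    (hm : measure G A X C + r ≤ m) :
    (T.ncard : ℝ) ≤ y⁻¹ ^ (r + weight G A X C w) * y ^ m + ((T ∩ {S | w ∉ S}).ncard : ℝ) ∧
      T ∩ {S | w ∉ S} ⊆ maxForests G A (X \ {w}) ∧
      measure G A (X \ {w}) C + (r + weight G A X C w) ≤ m := by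
  obtain ⟨h1, h2⟩ := ncard_maxForests_split_le T hT w
  refine ⟨?_, h2, ?_⟩
  · have h3 := h.include_le hy hC hwX hwA hm
    have h4 : (T.ncard : ℝ) ≤
        ((maxForests G (insert w A) X).ncard : ℝ) + ((T ∩ {S | w ∉ S}).ncard : ℝ) := by
      exact_mod_cast h1
    linarith
  · have := measure_add_weight_le (G := G) (A := A) (X := X) (C := C) (A' := A) (X' := X \ {w})
      (C' := C) (w := w) subset_rfl Set.sdiff_subset subset_rfl (fun hh => hh.1.2 rfl)
    omega

end Count

section Count

variable {V : Type*} [Fintype V] {G : SimpleGraph V} {A X C : Set V} {v w : V}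

/-- The inequalities between powers of the branching factor, one for each branching rule. -/
structure IsBranchingFactor (y : ℝ) : Prop where
  one_le : 1 ≤ y
  start : y⁻¹ ^ 11 + y⁻¹ ^ 8 ≤ 1
  many : y⁻¹ ^ 15 + y⁻¹ ^ 5 ≤ 1
  near : y⁻¹ ^ 10 + y⁻¹ ^ 10 ≤ 1
  far : y⁻¹ ^ 8 + y⁻¹ ^ 13 ≤ 1
  far_far : y⁻¹ ^ 11 + (y⁻¹ ^ 13 + y⁻¹ ^ 21) ≤ 1
  far_near : y⁻¹ ^ 13 + (y⁻¹ ^ 13 + y⁻¹ ^ 18) ≤ 1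
  far_far_far : y⁻¹ ^ 14 + (y⁻¹ ^ 13 + (y⁻¹ ^ 21 + y⁻¹ ^ 29)) ≤ 1

/-- The value is slightly below the eighth root of 1.8638, because an untouched vertex has weight 8.
The inequality closest to equality is `far_far_far`. -/
theorem isBranchingFactor : IsBranchingFactor (1080935 / 1000000) := by
  constructor <;> norm_num

variable {y : ℝ} {m : ℕ}

omit [Fintype V] in
theorem ncard_inter_eq_zero (T : Set (Set V)) (w : V) (h : ∀ S ∈ T, w ∈ S) :
    ((T ∩ {S | w ∉ S}).ncard : ℝ) = 0 := by
  have : T ∩ {S | w ∉ S} = ∅ := by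
    ext S
    simp only [Set.mem_inter_iff, Set.mem_ofPred_eq, Set.mem_empty_iff_false, iff_false, not_and,
      not_not]
    exact h S
  rw [this, Set.ncard_empty, Nat.cast_zero]

-- Let `J` and `K` be the undecided generalised neighbours of `v` that do and do not touch `C`.
-- Taking `v` gains its own weight, 5 for each vertex of `J` (now excluded) and 8 - 5 = 3 for each
-- of `K` (now touching the component). A maximal forest avoiding `v` must meet `J ∪ K`, so if this
-- set is small one branches on its first member contained in the forest. The exponents in
-- `IsBranchingFactor` are the resulting total gains.
open Classical in
theorem BoundBelow.branch (h : BoundBelow G y m) (hy : IsBranchingFactor y) (hC : IsPart G A C)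
    (hvX : v ∈ X) (hvA : v ∉ A) (hv : C = ∅ ∨ ∃ c ∈ C, G.Adj v c) (hm : measure G A X C ≤ m) :
    ((maxForests G A X).ncard : ℝ) ≤ y ^ m := by
  have hy1 := hy.one_le
  have hy0 : (0 : ℝ) < y := by linarith
  have hz0 : (0 : ℝ) ≤ y⁻¹ := by positivity
  have hz1 : y⁻¹ ≤ 1 := inv_le_one_of_one_le₀ hy1
  have hM : (0 : ℝ) ≤ y ^ m := by positivity
  have hdel := measure_add_weight_le (G := G) (A := A) (X := X) (C := C) (A' := A) (X' := X \ {v})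
      (C' := C) (w := v) subset_rfl Set.sdiff_subset subset_rfl (fun hh => hh.1.2 rfl)
  have hw5 := five_le_weight (G := G) (C := C) hvX hvA
  by_cases hac : Acyc G (insert v A)
  swap
  · have h1 : maxForests G A X ⊆ maxForests G A (X \ {v}) :=
      maxForests_sdiff fun w hw => by rw [Set.mem_singleton_iff.1 hw]; exact hac
    have h2 : ((maxForests G A X).ncard : ℝ) ≤ ((maxForests G A (X \ {v})).ncard : ℝ) := by
      exact_mod_cast Set.ncard_le_ncard h1 (Set.toFinite _)
    have h3 := h.le (X := X \ {v}) (g := 5) hy1 hC (by norm_num) (by omega)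
    have h4 : y⁻¹ ^ 5 * y ^ m ≤ 1 * y ^ m :=
      mul_le_mul_of_nonneg_right (pow_le_one₀ hz0 hz1) hM
    linarith
  set J : Finset V := Finset.univ.filter fun w =>
    w ∈ X ∧ w ∉ A ∧ (∃ c ∈ C, G.Adj w c) ∧ GAdj G A C v w with hJ
  set K : Finset V := Finset.univ.filter fun w =>
    w ∈ X ∧ w ∉ A ∧ (¬ ∃ c ∈ C, G.Adj w c) ∧ GAdj G A C v w with hK
  have memJ : ∀ w ∈ J, w ∈ X ∧ w ∉ A ∧ (∃ c ∈ C, G.Adj w c) ∧ GAdj G A C v w := by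
    intro w hw
    simpa [hJ] using hw
  have memK : ∀ w ∈ K, w ∈ X ∧ w ∉ A ∧ (¬ ∃ c ∈ C, G.Adj w c) ∧ GAdj G A C v w := by
    intro w hw
    simpa only [hK, Finset.mem_filter, Finset.mem_univ, true_and] using hw
  obtain ⟨hsplit, hT⟩ := ncard_maxForests_split_le (maxForests G A X) subset_rfl v
  set T := maxForests G A X ∩ {S | v ∉ S} with hTdef
  have hhit : ∀ S ∈ T, ∃ w, w ∈ S ∧ (w ∈ J ∨ w ∈ K) := by
    rintro S ⟨hS, hvS⟩
    obtain ⟨w, hwS, hwA, hvw⟩ := exists_gAdj hC hS hvX hvS hac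
    refine ⟨w, hwS, ?_⟩
    have hwX : w ∈ X := hS.2.1.1 hwS
    simp only [hJ, hK, Finset.mem_filter, Finset.mem_univ, true_and]
    by_cases hc : ∃ c ∈ C, G.Adj w c
    · exact Or.inl ⟨hwX, hwA, hc, hvw⟩
    · exact Or.inr ⟨hwX, hwA, hc, hvw⟩
  have hI : ((maxForests G (insert v A) X).ncard : ℝ) ≤
      y⁻¹ ^ (weight G A X C v + 5 * J.card + 3 * K.card) * y ^ m := by
    have h1 : maxForests G (insert v A) X ⊆ maxForests G (insert v A) (X \ J) := by
      refine maxForests_sdiff fun w hw => ?_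
      obtain ⟨-, hwA, hwC, hvw⟩ := memJ w (Finset.mem_coe.1 hw)
      rcases hv with rfl | hv
      · obtain ⟨c, hc, -⟩ := hwC
        exact hc.elim
      · exact not_acyc_of_gAdj hC hvA hwA hv hwC hvw
    have h2 : ((maxForests G (insert v A) X).ncard : ℝ) ≤
        ((maxForests G (insert v A) (X \ J)).ncard : ℝ) := by
      exact_mod_cast Set.ncard_le_ncard h1 (Set.toFinite _)
    refine h2.trans ?_
    have hpart : IsPart G (insert v A) (closureIn G (insert v A) (insert v C)) := by
      refine isPart_closureIn (Set.insert_subset_insert hC.subset) ?_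
      have hvc : ∀ p ∈ C, Conn G (insert v A) v p := by
        intro p hp
        rcases hv with rfl | ⟨c, hc, hvc⟩
        · exact hp.elim
        · exact (Conn.single hvc (Set.mem_insert _ _)
            (Set.mem_insert_of_mem _ (hC.subset hc))).trans
            ((hC.conn c hc p hp).mono (Set.subset_insert _ _))
      rintro p (rfl | hp) q (rfl | hq)
      · exact Conn.refl _
      · exact hvc q hq
      · exact (hvc p hp).symm
      · exact (hC.conn p hp q hq).mono (Set.subset_insert _ _)
    refine h.le hy1 hpart (by omega) (le_trans (measure_include_le J K hvX hvA ?_ memK) hm)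
    intro w hw
    obtain ⟨h1, h2, h3, h4⟩ := memJ w hw
    exact ⟨h1, h2, h3, h4.1.symm⟩
  have htot : ((maxForests G A X).ncard : ℝ) ≤
      ((maxForests G (insert v A) X).ncard : ℝ) + (T.ncard : ℝ) := by exact_mod_cast hsplit
  have hmul : ∀ s : ℝ, s ≤ 1 → s * y ^ m ≤ y ^ m := fun s hs =>
    mul_le_of_le_one_left hM hs
  have hT0 : (T.ncard : ℝ) ≤ y⁻¹ ^ weight G A X C v * y ^ m := by
    have h1 : (T.ncard : ℝ) ≤ ((maxForests G A (X \ {v})).ncard : ℝ) := by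
      exact_mod_cast Set.ncard_le_ncard hT (Set.toFinite _)
    exact h1.trans (h.le hy1 hC (by omega) (by omega))
  have hpow : ∀ {a b : ℕ}, a ≤ b → y⁻¹ ^ b * y ^ m ≤ y⁻¹ ^ a * y ^ m := fun hab =>
    mul_le_mul_of_nonneg_right (pow_le_pow_of_le_one hz0 hz1 hab) hM
  by_cases hcard : J.card = 0 ∧ K.card = 0
  · have hT1 : T = ∅ := by
      ext S
      simp only [Set.mem_empty_iff_false, iff_false]
      intro hS
      obtain ⟨w, -, hw⟩ := hhit S hS
      rw [Finset.card_eq_zero, Finset.card_eq_zero] at hcard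
      rw [hcard.1, hcard.2] at hw
      simp at hw
    rw [hT1, Set.ncard_empty, Nat.cast_zero] at htot
    have := hmul _ (pow_le_one₀ (n := weight G A X C v + 5 * J.card + 3 * K.card) hz0 hz1)
    linarith
  -- With `C` empty, `J` is empty and `K` is not, so taking `v` gains at least 8 + 3 and dropping it
  -- gains 8.
  rcases hv with rfl | hv
  · have hJ0 : J = ∅ := by
      ext w
      simp only [Finset.notMem_empty, iff_false]
      intro hw
      obtain ⟨-, -, ⟨c, hc, -⟩, -⟩ := memJ w hw
      exact hc.elim
    have hwt : weight G A X ∅ v = 8 :=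
      weight_not_adj hvX hvA (by rintro ⟨c, hc, -⟩; exact hc.elim)
    rw [hJ0, Finset.card_empty] at hcard
    rw [hwt] at hT0 hI
    have h1 : 11 ≤ 8 + 5 * J.card + 3 * K.card := by omega
    have h2 := hpow h1
    have h3 := hmul _ hy.start
    linarith
  have hwt : weight G A X C v = 5 := weight_adj hvX hvA hv
  rw [hwt] at hI hT0 hdel
  -- Here plain branching on `v` suffices, with gains 5 + 10 and 5. Below this threshold only five
  -- pairs of cardinalities remain.
  by_cases hbig : 10 ≤ 5 * J.card + 3 * K.card
  · have h1 : 15 ≤ 5 + 5 * J.card + 3 * K.card := by omega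
    have h2 := hpow h1
    have h3 := hmul _ hy.many
    linarith
  have hmT : measure G A (X \ {v}) C + 5 ≤ m := by omega
  have fwt : ∀ {X' : Set V} {w : V}, w ∈ K → w ∈ X' → weight G A X' C w = 8 := by
    intro X' w hw hwX'
    obtain ⟨-, h2, h3, -⟩ := memK w hw
    exact weight_not_adj hwX' h2 h3
  have nwt : ∀ {X' : Set V} {w : V}, w ∈ J → w ∈ X' → weight G A X' C w = 5 := by
    intro X' w hw hwX'
    obtain ⟨-, h2, h3, -⟩ := memJ w hw
    exact weight_adj hwX' h2 h3
  have Kmem : ∀ w ∈ K, w ∈ X \ {v} := fun w hw =>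
    ⟨(memK w hw).1, fun hh => (memK w hw).2.2.2.1 hh.symm⟩
  have Jmem : ∀ w ∈ J, w ∈ X \ {v} := fun w hw =>
    ⟨(memJ w hw).1, fun hh => (memJ w hw).2.2.2.1 hh.symm⟩
  have hcases : (J.card = 0 ∧ K.card = 1) ∨ (J.card = 0 ∧ K.card = 2) ∨
      (J.card = 0 ∧ K.card = 3) ∨ (J.card = 1 ∧ K.card = 0) ∨ (J.card = 1 ∧ K.card = 1) := by
    omega
  rcases hcases with ⟨hj, hk⟩ | ⟨hj, hk⟩ | ⟨hj, hk⟩ | ⟨hj, hk⟩ | ⟨hj, hk⟩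
  all_goals rw [hj, hk] at hI
  · rw [Finset.card_eq_zero] at hj
    obtain ⟨a, hKa⟩ := Finset.card_eq_one.1 hk
    have ha : a ∈ K := by simp [hKa]
    obtain ⟨h1, h2, h3⟩ := h.family_le hy1 hC hT (Kmem a ha) (memK a ha).2.1 hmT
    rw [ncard_inter_eq_zero T a, fwt ha (Kmem a ha)] at h1
    · have := hmul _ hy.far
      linarith
    · intro S hS
      obtain ⟨w, hwS, hw⟩ := hhit S hS
      simp only [hj, hKa, Finset.notMem_empty, Finset.mem_singleton, false_or] at hw
      exact hw ▸ hwS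
  · rw [Finset.card_eq_zero] at hj
    obtain ⟨a, b, hab, hKab⟩ := Finset.card_eq_two.1 hk
    have ha : a ∈ K := by simp [hKab]
    have hb : b ∈ K := by simp [hKab]
    have hb' : b ∈ (X \ {v}) \ {a} := ⟨Kmem b hb, fun hh => hab hh.symm⟩
    obtain ⟨h1, h2, h3⟩ := h.family_le hy1 hC hT (Kmem a ha) (memK a ha).2.1 hmT
    obtain ⟨h4, h5, h6⟩ := h.family_le hy1 hC h2 hb' (memK b hb).2.1 h3
    rw [fwt ha (Kmem a ha)] at h1 h4
    rw [ncard_inter_eq_zero (T ∩ {S | a ∉ S}) b, fwt hb hb'] at h4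
    · have := hmul _ hy.far_far
      linarith
    · rintro S ⟨hS, haS⟩
      obtain ⟨w, hwS, hw⟩ := hhit S hS
      simp only [hj, hKab, Finset.notMem_empty, Finset.mem_singleton, Finset.mem_insert,
        false_or] at hw
      rcases hw with rfl | rfl
      · exact absurd hwS haS
      · exact hwS
  · rw [Finset.card_eq_zero] at hj
    obtain ⟨a, b, c, hab, hac', hbc, hKabc⟩ := Finset.card_eq_three.1 hk
    have ha : a ∈ K := by simp [hKabc]
    have hb : b ∈ K := by simp [hKabc]
    have hc : c ∈ K := by simp [hKabc]
    have hb' : b ∈ (X \ {v}) \ {a} := ⟨Kmem b hb, fun hh => hab hh.symm⟩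
    have hc' : c ∈ ((X \ {v}) \ {a}) \ {b} :=
      ⟨⟨Kmem c hc, fun hh => hac' hh.symm⟩, fun hh => hbc hh.symm⟩
    obtain ⟨h1, h2, h3⟩ := h.family_le hy1 hC hT (Kmem a ha) (memK a ha).2.1 hmT
    obtain ⟨h4, h5, h6⟩ := h.family_le hy1 hC h2 hb' (memK b hb).2.1 h3
    obtain ⟨h7, h8, h9⟩ := h.family_le hy1 hC h5 hc' (memK c hc).2.1 h6
    rw [fwt ha (Kmem a ha)] at h1 h4 h7
    rw [fwt hb hb'] at h4 h7
    rw [ncard_inter_eq_zero (T ∩ {S | a ∉ S} ∩ {S | b ∉ S}) c, fwt hc hc'] at h7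
    · have := hmul _ hy.far_far_far
      linarith
    · rintro S ⟨⟨hS, haS⟩, hbS⟩
      obtain ⟨w, hwS, hw⟩ := hhit S hS
      simp only [hj, hKabc, Finset.notMem_empty, Finset.mem_singleton, Finset.mem_insert,
        false_or] at hw
      rcases hw with rfl | rfl | rfl
      · exact absurd hwS haS
      · exact absurd hwS hbS
      · exact hwS
  · rw [Finset.card_eq_zero] at hk
    obtain ⟨a, hJa⟩ := Finset.card_eq_one.1 hj
    have ha : a ∈ J := by simp [hJa]
    obtain ⟨h1, h2, h3⟩ := h.family_le hy1 hC hT (Jmem a ha) (memJ a ha).2.1 hmT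
    rw [ncard_inter_eq_zero T a, nwt ha (Jmem a ha)] at h1
    · have := hmul _ hy.near
      linarith
    · intro S hS
      obtain ⟨w, hwS, hw⟩ := hhit S hS
      simp only [hk, hJa, Finset.notMem_empty, Finset.mem_singleton, or_false] at hw
      exact hw ▸ hwS
  · obtain ⟨a, hKa⟩ := Finset.card_eq_one.1 hk
    obtain ⟨b, hJb⟩ := Finset.card_eq_one.1 hj
    have ha : a ∈ K := by simp [hKa]
    have hb : b ∈ J := by simp [hJb]
    have hb' : b ∈ (X \ {v}) \ {a} :=
      ⟨Jmem b hb, fun hh => (memK a ha).2.2.1 (hh ▸ (memJ b hb).2.2.1)⟩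
    obtain ⟨h1, h2, h3⟩ := h.family_le hy1 hC hT (Kmem a ha) (memK a ha).2.1 hmT
    obtain ⟨h4, h5, h6⟩ := h.family_le hy1 hC h2 hb' (memJ b hb).2.1 h3
    rw [fwt ha (Kmem a ha)] at h1 h4
    rw [ncard_inter_eq_zero (T ∩ {S | a ∉ S}) b, nwt hb hb'] at h4
    · have := hmul _ hy.far_near
      linarith
    · rintro S ⟨hS, haS⟩
      obtain ⟨w, hwS, hw⟩ := hhit S hS
      simp only [hKa, hJb, Finset.mem_singleton] at hw
      rcases hw with rfl | rfl
      · exact hwS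
      · exact absurd hwS haS

/-- Induction on the measure: branch next to `C` when possible, and otherwise start afresh with an
empty component. When no vertex is undecided, only `A` itself can occur. -/
theorem ncard_maxForests_le (hy : IsBranchingFactor y) (m : ℕ) : ∀ A X C : Set V, IsPart G A C →
    measure G A X C = m → ((maxForests G A X).ncard : ℝ) ≤ y ^ m := by
  induction m using Nat.strong_induction_on with
  | _ m ih =>
    intro A X C hC hm
    have h : BoundBelow G y m := fun A X C hC hm => ih _ hm A X C hC rfl
    by_cases hB : ∃ v, v ∈ X ∧ v ∉ A ∧ ∃ c ∈ C, G.Adj v c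
    · obtain ⟨v, hvX, hvA, hv⟩ := hB
      exact h.branch hy hC hvX hvA (Or.inr hv) hm.le
    by_cases hU : ∃ v, v ∈ X ∧ v ∉ A
    · obtain ⟨v, hvX, hvA⟩ := hU
      -- No undecided vertex touches `C`, so all weights are already 8 and replacing `C` by `∅` does
      -- not raise the measure.
      refine h.branch hy isPart_empty hvX hvA (Or.inl rfl) ?_
      rw [← hm]
      refine Finset.sum_le_sum fun w _ => ?_
      by_cases hw : w ∈ X ∧ w ∉ A
      · rw [weight_not_adj hw.1 hw.2 fun hc => hB ⟨w, hw.1, hw.2, hc⟩,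
          weight_not_adj hw.1 hw.2 (by rintro ⟨c, hc, -⟩; exact hc.elim)]
      · rw [weight_eq_zero hw]; exact Nat.zero_le _
    · push Not at hU
      have h1 : (maxForests G A X).ncard ≤ 1 := by
        rw [Set.ncard_le_one (Set.toFinite _)]
        have : ∀ S ∈ maxForests G A X, S = A := fun S hS =>
          (hS.2.1.1.trans hU).antisymm hS.1
        intro S hS S' hS'
        rw [this S hS, this S' hS']
      calc ((maxForests G A X).ncard : ℝ) ≤ 1 := by exact_mod_cast h1
        _ ≤ y ^ m := one_le_pow₀ hy.one_le

theorem F_le (N : ℕ) : (F N : ℝ) ≤ (1.8638 : ℝ) ^ N := by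
  classical
  obtain ⟨H, -, hH⟩ := Finset.exists_mem_eq_sup (Finset.univ : Finset (SimpleGraph (Fin N)))
    Finset.univ_nonempty fun G => (maximalInducedForests G).ncard
  have hF : F N = (maximalInducedForests H).ncard := by
    rw [← hH, F]
  have h1 : maximalInducedForests H = maxForests H ∅ Set.univ := by
    ext S
    simp [maximalInducedForests, maxForests]
  have h2 : measure H ∅ Set.univ ∅ = 8 * N := by
    rw [measure, Finset.sum_congr rfl (g := fun _ => 8)]
    · simp [mul_comm]
    · intro w _
      exact weight_not_adj (Set.mem_univ _) (Set.notMem_empty _) (by simp)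
  rw [hF, h1]
  refine (ncard_maxForests_le isBranchingFactor _ ∅ Set.univ ∅ isPart_empty h2).trans ?_
  rw [pow_mul]
  exact pow_le_pow_left₀ (by norm_num) (by norm_num) _

end Count

/-! ### Contracting a connected set -/

section Collapse

variable {V W : Type*} {G : SimpleGraph V} {H : SimpleGraph W}

/-- `π` contracts the connected set `Z` and maps `G[P]` onto `H[π '' P]`. -/
structure Collapses (G : SimpleGraph V) (H : SimpleGraph W) (π : V → W) (Z P : Set V) :
    Prop where
  subset : Z ⊆ P
  conn : ∀ x ∈ Z, ∀ y ∈ Z, Conn G Z x y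
  eq_of_mem : ∀ x ∈ Z, ∀ y ∈ Z, π x = π y
  inj : ∀ x ∈ P, ∀ y ∈ P, π x = π y → x = y ∨ (x ∈ Z ∧ y ∈ Z)
  map_adj : ∀ x ∈ P, ∀ y ∈ P, π x ≠ π y → G.Adj x y → H.Adj (π x) (π y)
  lift_adj : ∀ x ∈ P, ∀ y ∈ P, H.Adj (π x) (π y) →
    ∃ x' y', (x = x' ∨ (x ∈ Z ∧ x' ∈ Z)) ∧ (y = y' ∨ (y ∈ Z ∧ y' ∈ Z)) ∧ G.Adj x' y'
  unique : ∀ q ∈ P, q ∉ Z → ∀ x ∈ Z, ∀ y ∈ Z, G.Adj q x → G.Adj q y → x = y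

variable {π : V → W} {Z P : Set V}

theorem Collapses.mono {P' : Set V} (h : Collapses G H π Z P) (hZ : Z ⊆ P') (hP : P' ⊆ P) :
    Collapses G H π Z P' where
  subset := hZ
  conn := h.conn
  eq_of_mem := h.eq_of_mem
  inj x hx y hy := h.inj x (hP hx) y (hP hy)
  map_adj x hx y hy := h.map_adj x (hP hx) y (hP hy)
  lift_adj x hx y hy := h.lift_adj x (hP hx) y (hP hy)
  unique q hq := h.unique q (hP hq)

theorem Collapses.mem_of_rel (h : Collapses G H π Z P) {x x' : V} (hx : x ∈ P)
    (hxx : x = x' ∨ (x ∈ Z ∧ x' ∈ Z)) : x' ∈ P := by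
  rcases hxx with rfl | ⟨-, h'⟩
  · exact hx
  · exact h.subset h'

theorem Collapses.conn_of_rel (h : Collapses G H π Z P) {x x' : V}
    (hxx : x = x' ∨ (x ∈ Z ∧ x' ∈ Z)) : Conn G P x x' := by
  rcases hxx with rfl | ⟨h1, h2⟩
  · exact Conn.refl _
  · exact (h.conn x h1 x' h2).mono h.subset

theorem Collapses.conn_iff (h : Collapses G H π Z P) {x y : V} (hx : x ∈ P) (hy : y ∈ P) :
    Conn G P x y ↔ Conn H (π '' P) (π x) (π y) := by
  constructor
  · intro hc
    clear hy
    induction hc with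
    | refl => exact Conn.refl _
    | @tail p q _ hst ih =>
      by_cases heq : π p = π q
      · rw [← heq]; exact ih
      · exact ih.trans (Conn.single (h.map_adj p hst.2.1 q hst.2.2 heq hst.1)
          (Set.mem_image_of_mem _ hst.2.1) (Set.mem_image_of_mem _ hst.2.2))
  · intro hc
    generalize hb : π y = b at hc
    induction hc generalizing y with
    | refl => exact h.conn_of_rel (h.inj x hx y hy hb.symm)
    | @tail p q _ hst ih =>
      obtain ⟨hpq, ⟨p, hp, rfl⟩, -⟩ := hst
      have h1 := ih hp rfl
      rw [← hb] at hpq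
      obtain ⟨p', y', hp', hy', hadj⟩ := h.lift_adj p hp y hy hpq
      exact h1.trans ((h.conn_of_rel hp').trans ((Conn.single hadj (h.mem_of_rel hp hp')
        (h.mem_of_rel hy hy')).trans (h.conn_of_rel hy').symm))

/-- `P` is built up from `Z` one vertex at a time, and the insertion criterion for forests is
compared on both sides. The field `unique` is indispensable: two edges from one vertex to `Z` become
a single edge after contraction, which would hide a cycle. -/
theorem Collapses.acyc_iff [Finite V] (h : Collapses G H π Z P) (hZ : Acyc G Z) :
    Acyc G P ↔ Acyc H (π '' P) := by
  have key : ∀ Q : Set V, Q ⊆ P → (Acyc G (Z ∪ Q) ↔ Acyc H (π '' (Z ∪ Q))) := by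
    intro Q
    induction Q, Set.toFinite Q using Set.Finite.induction_on with
    | empty =>
      intro _
      rw [Set.union_empty]
      refine ⟨fun _ => ?_, fun _ => hZ⟩
      have : Subsingleton (π '' Z) := by
        rw [Set.subsingleton_coe]
        rintro _ ⟨x, hx, rfl⟩ _ ⟨y, hy, rfl⟩
        exact h.eq_of_mem x hx y hy
      exact IsAcyclic.of_subsingleton
    | @insert q Q hqQ _ ih =>
      intro hsub
      have hQ : Q ⊆ P := (Set.subset_insert _ _).trans hsub
      have hqP : q ∈ P := hsub (Set.mem_insert _ _)
      have ih := ih hQ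
      by_cases hqZ : q ∈ Z
      · have : Z ∪ insert q Q = Z ∪ Q := by
          rw [Set.union_insert, Set.insert_eq_of_mem (Set.mem_union_left _ hqZ)]
        rw [this]
        exact ih
      have hPP : Z ∪ Q ⊆ P := Set.union_subset h.subset hQ
      have h' : Collapses G H π Z (Z ∪ Q) := h.mono Set.subset_union_left hPP
      have hq : q ∉ Z ∪ Q := fun hh => hh.elim hqZ hqQ
      have hπq : π q ∉ π '' (Z ∪ Q) := by
        rintro ⟨x, hx, hxq⟩
        rcases h.inj x (hPP hx) q hqP hxq with rfl | h2
        · exact hq hx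
        · exact hqZ h2.2
      rw [Set.union_insert, Set.image_insert_eq, acyc_insert_iff hq, acyc_insert_iff hπq, ih]
      refine and_congr_right fun _ => ⟨?_, ?_⟩
      · rintro hG _ ⟨x, hx, rfl⟩ _ ⟨y, hy, rfl⟩ hqx hqy hc
        obtain ⟨q1, x', hq1, hx', hax⟩ := h.lift_adj q hqP x (hPP hx) hqx
        obtain ⟨q2, y', hq2, hy', hay⟩ := h.lift_adj q hqP y (hPP hy) hqy
        obtain rfl : q = q1 := hq1.resolve_right fun hh => hqZ hh.1
        obtain rfl : q = q2 := hq2.resolve_right fun hh => hqZ hh.1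
        have hxy' : x' = y' := hG x' (h'.mem_of_rel hx hx') y' (h'.mem_of_rel hy hy') hax hay
          ((h'.conn_of_rel hx').symm.trans (((h'.conn_iff hx hy).2 hc).trans (h'.conn_of_rel hy')))
        have e1 : π x = π x' := by
          rcases hx' with rfl | hx'
          · rfl
          · exact h.eq_of_mem _ hx'.1 _ hx'.2
        have e2 : π y = π y' := by
          rcases hy' with rfl | hy'
          · rfl
          · exact h.eq_of_mem _ hy'.1 _ hy'.2
        rw [e1, e2, hxy']
      · intro hH x hx y hy hqx hqy hc
        have hne : ∀ z ∈ Z ∪ Q, π q ≠ π z := fun z hz hh => hπq ⟨z, hz, hh.symm⟩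
        have e := hH _ (Set.mem_image_of_mem π hx) _ (Set.mem_image_of_mem π hy)
          (h.map_adj q hqP x (hPP hx) (hne x hx) hqx) (h.map_adj q hqP y (hPP hy) (hne y hy) hqy)
          ((h'.conn_iff hx hy).1 hc)
        rcases h.inj x (hPP hx) y (hPP hy) e with rfl | ⟨hxZ, hyZ⟩
        · rfl
        · exact h.unique q hqP hqZ x hxZ y hyZ hqx hqy
  have := key P subset_rfl
  rwa [Set.union_eq_self_of_subset_left h.subset] at this

/-- Isolated vertices do not matter for acyclicity. -/
theorem acyc_union_isolated [Finite V] {A R : Set V} (hR : ∀ r ∈ R, ∀ x, ¬ G.Adj r x)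
    (hA : Acyc G A) : Acyc G (A ∪ R) := by
  induction R, Set.toFinite R using Set.Finite.induction_on with
  | empty => rwa [Set.union_empty]
  | @insert r R hrR _ ih =>
    have ih := ih fun r hr => hR r (Set.mem_insert_of_mem _ hr)
    rw [Set.union_insert]
    by_cases hr : r ∈ A ∪ R
    · rwa [Set.insert_eq_of_mem hr]
    · exact (acyc_insert_iff hr).2 ⟨ih, fun x _ _ _ h => absurd h (hR r (Set.mem_insert _ _) x)⟩

end Collapse

/-! ### Reduction to the extremal functions `F` and `M 0` -/

section Extremal

variable {V W : Type*} [Finite V] [Finite W] {G : SimpleGraph V}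

-- Padding `H` with isolated vertices reaches exactly `N` vertices. They belong to every maximal
-- forest, so adding all of them maps maximal forests injectively to maximal forests.
omit [Finite V] in
theorem ncard_maximalInducedForests_le_F (H : SimpleGraph W) {N : ℕ} (hN : Nat.card W ≤ N) :
    (maximalInducedForests H).ncard ≤ F N := by
  classical
  have : Fintype W := Fintype.ofFinite W
  rw [Nat.card_eq_fintype_card] at hN
  obtain ⟨f⟩ : Nonempty (W ↪ Fin N) := by
    rw [Function.Embedding.nonempty_iff_card_le, Fintype.card_fin]
    exact hN
  have hiso : ∀ r ∈ (Set.range f)ᶜ, ∀ x, ¬ (H.map f).Adj r x := by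
    rintro r hr x hadj
    rw [SimpleGraph.map_adj] at hadj
    obtain ⟨a, b, _, rfl, _⟩ := hadj
    exact hr ⟨a, rfl⟩
  have hcol : ∀ P : Set W, Collapses H (H.map f) f ∅ P := fun P =>
    { subset := Set.empty_subset _
      conn := fun _ h => h.elim
      eq_of_mem := fun _ h => h.elim
      inj := fun x _ y _ h => Or.inl (f.injective h)
      map_adj := fun x _ y _ _ h => (SimpleGraph.map_adj_apply).2 h
      lift_adj := fun x _ y _ h => ⟨x, y, Or.inl rfl, Or.inl rfl, (SimpleGraph.map_adj_apply).1 h⟩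
      unique := fun _ _ _ _ h => h.elim }
  have hac : ∀ P : Set W, Acyc H P ↔ Acyc (H.map f) (f '' P) := fun P =>
    (hcol P).acyc_iff acyc_empty
  have hpre : ∀ S : Set W, f ⁻¹' (f '' S ∪ (Set.range f)ᶜ) = S := by
    intro S
    ext x
    simp
  have hF : (maximalInducedForests (H.map f)).ncard ≤ F N :=
    Finset.le_sup (f := fun G : SimpleGraph (Fin N) => (maximalInducedForests G).ncard)
      (Finset.mem_univ (H.map f))
  refine le_trans (Set.ncard_le_ncard_of_injOn (fun S => f '' S ∪ (Set.range f)ᶜ) ?_ ?_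
    (Set.toFinite _)) hF
  · intro S hS
    refine ⟨acyc_union_isolated hiso ((hac S).1 hS.1), ?_⟩
    intro T hT hST
    have h1 : f '' (f ⁻¹' T) ⊆ T := Set.image_preimage_subset _ _
    have h2 : Acyc H (f ⁻¹' T) := (hac _).2 (Acyc.mono hT h1)
    have h3 : S ⊆ f ⁻¹' T := by
      rw [← hpre S]
      exact Set.preimage_mono hST
    have h4 := hS.2 h2 h3
    intro x hx
    by_cases hxr : x ∈ Set.range f
    · obtain ⟨a, rfl⟩ := hxr
      exact Or.inl ⟨a, h4 hx, rfl⟩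
    · exact Or.inr hxr
  · intro S _ S' _ h
    rw [← hpre S, ← hpre S']
    exact congrArg _ h

/-- Maximal forests that contain a fixed connected set correspond to maximal forests of the graph
in which this set is contracted. -/
theorem ncard_maxForests_le_F {Z X : Set V} (hZ : Z.Nonempty) (hZX : Z ⊆ X)
    (hconn : ∀ x ∈ Z, ∀ y ∈ Z, Conn G Z x y) {N : ℕ} (hN : (X \ Z).ncard + 1 ≤ N) :
    (maxForests G Z X).ncard ≤ F N := by
  classical
  by_cases hZac : Acyc G Z
  swap
  · have : maxForests G Z X = ∅ := by
      ext S
      simp only [Set.mem_empty_iff_false, iff_false]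
      exact fun hS => hZac (Acyc.mono hS.2.1.2 hS.1)
    rw [this, Set.ncard_empty]
    exact Nat.zero_le _
  -- A vertex with two neighbours in the connected set `Z` closes a cycle, so it lies in no forest
  -- containing `Z` and can be discarded. In `H`, `none` is the contracted `Z`; it accounts for the
  -- `+ 1` in the vertex count.
  let X₀ : Set V := {q | q ∈ X \ Z ∧ ∀ x ∈ Z, ∀ y ∈ Z, G.Adj q x → G.Adj q y → x = y}
  let H : SimpleGraph (Option X₀) :=
    { Adj := fun a b => match a, b with
        | none, none => False
        | some a, some b => G.Adj a b
        | some a, none => ∃ z ∈ Z, G.Adj a z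
        | none, some b => ∃ z ∈ Z, G.Adj b z
      symm := by
        constructor
        rintro (_ | a) (_ | b) h
        · exact h
        · exact h
        · exact h
        · exact G.symm.symm _ _ h
      loopless := by
        constructor
        rintro (_ | a) h
        · exact h
        · exact G.loopless.irrefl _ h }
  have hcard : Nat.card (Option X₀) ≤ N := by
    rw [Finite.card_option]
    have h1 : Nat.card X₀ ≤ (X \ Z).ncard := by
      rw [Nat.card_coe_set_eq]
      exact Set.ncard_le_ncard (fun x hx => hx.1) (Set.toFinite _)
    omega
  let π : V → Option X₀ := fun x => if h : x ∈ X₀ then some ⟨x, h⟩ else none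
  have hπZ : ∀ x ∈ Z, π x = none := fun x hx => dif_neg fun h => h.1.2 hx
  have hπX : ∀ x (hx : x ∈ X₀), π x = some ⟨x, hx⟩ := fun x hx => dif_pos hx
  have hcol : Collapses G H π Z (Z ∪ X₀) :=
    { subset := Set.subset_union_left
      conn := hconn
      eq_of_mem := fun x hx y hy => by rw [hπZ x hx, hπZ y hy]
      inj := by
        rintro x (hx | hx) y (hy | hy) h
        · exact Or.inr ⟨hx, hy⟩
        · rw [hπZ x hx, hπX y hy] at h
          cases h
        · rw [hπX x hx, hπZ y hy] at h
          cases h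
        · rw [hπX x hx, hπX y hy] at h
          exact Or.inl (congrArg Subtype.val (Option.some.inj h))
      map_adj := by
        rintro x (hx | hx) y (hy | hy) hne h
        · exact absurd ((hπZ x hx).trans (hπZ y hy).symm) hne
        · rw [hπZ x hx, hπX y hy]
          exact ⟨x, hx, h.symm⟩
        · rw [hπX x hx, hπZ y hy]
          exact ⟨y, hy, h⟩
        · rw [hπX x hx, hπX y hy]
          exact h
      lift_adj := by
        rintro x (hx | hx) y (hy | hy) h
        · rw [hπZ x hx, hπZ y hy] at h
          exact h.elim
        · rw [hπZ x hx, hπX y hy] at h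
          obtain ⟨z, hz, hadj⟩ := h
          exact ⟨z, y, Or.inr ⟨hx, hz⟩, Or.inl rfl, hadj.symm⟩
        · rw [hπX x hx, hπZ y hy] at h
          obtain ⟨z, hz, hadj⟩ := h
          exact ⟨x, z, Or.inl rfl, Or.inr ⟨hy, hz⟩, hadj⟩
        · rw [hπX x hx, hπX y hy] at h
          exact ⟨x, y, Or.inl rfl, Or.inl rfl, h⟩
      unique := by
        rintro q (hq | hq) hqZ
        · exact absurd hq hqZ
        · exact hq.2 }
  have hac : ∀ Q, Z ⊆ Q → Q ⊆ Z ∪ X₀ → (Acyc G Q ↔ Acyc H (π '' Q)) := fun Q h1 h2 =>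
    (hcol.mono h1 h2).acyc_iff hZac
  have hsub : ∀ S ∈ maxForests G Z X, S ⊆ Z ∪ X₀ := by
    intro S hS q hq
    by_cases hqZ : q ∈ Z
    · exact Or.inl hqZ
    · refine Or.inr ⟨⟨hS.2.1.1 hq, hqZ⟩, fun x hx y hy hqx hqy => ?_⟩
      by_contra hne
      exact not_acyc_of_conn hS.1 hq hqZ hx hy hne hqx hqy (hconn x hx y hy) hS.2.1.2
  have hback : ∀ S ∈ maxForests G Z X, S = Z ∪ {x | ∃ h : x ∈ X₀, some ⟨x, h⟩ ∈ π '' S} := by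
    intro S hS
    ext x
    constructor
    · intro hx
      rcases hsub S hS hx with h | h
      · exact Or.inl h
      · exact Or.inr ⟨h, x, hx, hπX x h⟩
    · rintro (h | ⟨h, y, hy, hxy⟩)
      · exact hS.1 h
      · rcases hsub S hS hy with hy' | hy'
        · rw [hπZ y hy'] at hxy
          cases hxy
        · rw [hπX y hy'] at hxy
          have : y = x := congrArg Subtype.val (Option.some.inj hxy)
          exact this ▸ hy
  refine le_trans (Set.ncard_le_ncard_of_injOn (fun S => π '' S) ?_ ?_ (Set.toFinite _))
    (ncard_maximalInducedForests_le_F H hcard)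
  · intro S hS
    refine ⟨(hac S hS.1 (hsub S hS)).1 hS.2.1.2, ?_⟩
    intro T hT hST
    let T' : Set V := Z ∪ {x | ∃ h : x ∈ X₀, some ⟨x, h⟩ ∈ T}
    have hT'sub : T' ⊆ Z ∪ X₀ := by
      rintro x (h | ⟨h, -⟩)
      · exact Or.inl h
      · exact Or.inr h
    have hnone : none ∈ T := by
      obtain ⟨z, hz⟩ := hZ
      exact hST ⟨z, hS.1 hz, hπZ z hz⟩
    have himg : π '' T' = T := by
      ext b
      constructor
      · rintro ⟨x, hx | ⟨h, hx⟩, rfl⟩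
        · rw [hπZ x hx]; exact hnone
        · rw [hπX x h]; exact hx
      · intro hb
        rcases b with _ | ⟨x, hx⟩
        · obtain ⟨z, hz⟩ := hZ
          exact ⟨z, Or.inl hz, hπZ z hz⟩
        · exact ⟨x, Or.inr ⟨hx, hb⟩, hπX x hx⟩
    have h1 : Acyc G T' := (hac T' Set.subset_union_left hT'sub).2 (himg ▸ hT)
    have h2 : T' ⊆ X := by
      rintro x (h | ⟨h, -⟩)
      · exact hZX h
      · exact h.1.1
    have h3 : S ⊆ T' := by
      intro x hx
      rcases hsub S hS hx with h | h
      · exact Or.inl h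
      · exact Or.inr ⟨h, hST ⟨x, hx, hπX x h⟩⟩
    have h4 := hS.2.2 ⟨h2, h1⟩ h3
    change T ⊆ π '' S
    rw [← himg]
    exact Set.image_mono h4
  · intro S hS S' hS' h
    rw [hback S hS, hback S' hS']
    simp only at h
    rw [h]

/-- The inclusion-maximal independent subsets of `X`. -/
def maxIndep (G : SimpleGraph V) (X : Set V) : Set (Set V) :=
  {S | Maximal (fun T => T ⊆ X ∧ ∀ u ∈ T, ∀ v ∈ T, ¬ G.Adj u v) S}

omit [Finite W] in
theorem forall_encard_le_zero_iff (H : SimpleGraph W) (T : Set W) :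
    (∀ v ∈ T, (H.neighborSet v ∩ T).encard ≤ ((0 : ℕ) : ℕ∞)) ↔
      ∀ u ∈ T, ∀ v ∈ T, ¬ H.Adj u v := by
  refine forall₂_congr fun u _ => ?_
  rw [Nat.cast_zero, nonpos_iff_eq_zero, Set.encard_eq_zero]
  constructor
  · intro h v hv huv
    have : v ∈ H.neighborSet u ∩ T := ⟨huv, hv⟩
    rw [h] at this
    exact this
  · intro h
    ext v
    simp only [Set.mem_inter_iff, SimpleGraph.mem_neighborSet, Set.mem_empty_iff_false, iff_false,
      not_and]
    exact fun huv hv => h v hv huv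

theorem ncard_maxIndep_le_M {X : Set V} {N : ℕ} (hN : X.ncard ≤ N) :
    (maxIndep G X).ncard ≤ M 0 N := by
  classical
  obtain ⟨g⟩ : Nonempty (X ↪ Fin N) := by
    have : Fintype X := Fintype.ofFinite X
    rw [Function.Embedding.nonempty_iff_card_le, Fintype.card_fin, ← Nat.card_eq_fintype_card,
      Nat.card_coe_set_eq]
    exact hN
  let H : SimpleGraph (Fin N) := (G.induce X).map g
  have hH : ∀ x y : X, H.Adj (g x) (g y) ↔ G.Adj x y := fun x y => SimpleGraph.map_adj_apply
  have hHr : ∀ a b, H.Adj a b → a ∈ Set.range g ∧ b ∈ Set.range g := by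
    intro a b h
    obtain ⟨x, y, _, rfl, rfl⟩ := (SimpleGraph.map_adj _ _ _ _).1 h
    exact ⟨⟨x, rfl⟩, ⟨y, rfl⟩⟩
  -- Outside the range of `g` the condition is vacuous, so `Φ S` contains all padding vertices, as
  -- maximality demands.
  let Φ : Set V → Set (Fin N) := fun S => {a | ∀ x, g x = a → (x : V) ∈ S}
  have hΦ : ∀ S (x : X), g x ∈ Φ S ↔ (x : V) ∈ S := fun S x =>
    ⟨fun h => h x rfl, fun h y hy => by rwa [g.injective hy]⟩
  have hM : (maximalDegreeAtMost 0 H).ncard ≤ M 0 N :=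
    Finset.le_sup (f := fun G : SimpleGraph (Fin N) => (maximalDegreeAtMost 0 G).ncard)
      (Finset.mem_univ H)
  refine le_trans (Set.ncard_le_ncard_of_injOn Φ ?_ ?_ (Set.toFinite _)) hM
  · intro S hS
    have hmax : Maximal (fun T => ∀ u ∈ T, ∀ v ∈ T, ¬ H.Adj u v) (Φ S) := by
      constructor
      · intro a ha b hb hab
        obtain ⟨⟨x, rfl⟩, ⟨y, rfl⟩⟩ := hHr a b hab
        rw [hΦ] at ha hb
        exact hS.1.2 _ ha _ hb ((hH x y).1 hab)
      · intro T hT hST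
        have h1 : S ⊆ {x | ∃ h : x ∈ X, g ⟨x, h⟩ ∈ T} := fun x hx =>
          ⟨hS.1.1 hx, hST ((hΦ S _).2 hx)⟩
        have h2 : {x | ∃ h : x ∈ X, g ⟨x, h⟩ ∈ T} ⊆ S := by
          refine hS.2 ⟨fun x hx => hx.1, ?_⟩ h1
          rintro u ⟨hu, hu'⟩ v ⟨hv, hv'⟩ huv
          exact hT _ hu' _ hv' ((hH ⟨u, hu⟩ ⟨v, hv⟩).2 huv)
        rintro a ha x rfl
        exact h2 ⟨x.2, ha⟩
    simpa only [maximalDegreeAtMost, Set.mem_ofPred_eq, forall_encard_le_zero_iff] using hmax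
  · intro S hS S' hS' h
    ext x
    constructor
    · intro hx
      have := (hΦ S ⟨x, hS.1.1 hx⟩).2 hx
      rw [h] at this
      exact (hΦ S' _).1 this
    · intro hx
      have := (hΦ S' ⟨x, hS'.1.1 hx⟩).2 hx
      rw [← h] at this
      exact (hΦ S _).1 this

end Extremal

theorem ncard_le_of_cover {α ι : Type*} [Finite α] (s : Set α) (I : Finset ι) (f : ι → Set α)
    (k : ℕ) (hcov : ∀ x ∈ s, ∃ i ∈ I, x ∈ f i) (hk : ∀ i ∈ I, (f i).ncard ≤ k) :
    s.ncard ≤ I.card * k := by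
  classical
  have : Fintype α := Fintype.ofFinite α
  rw [Set.ncard_eq_toFinset_card' s]
  have h : s.toFinset ⊆ I.biUnion fun i => (f i).toFinset := by
    intro x hx
    rw [Set.mem_toFinset] at hx
    obtain ⟨i, hi, hxi⟩ := hcov x hx
    exact Finset.mem_biUnion.2 ⟨i, hi, Set.mem_toFinset.2 hxi⟩
  refine (Finset.card_le_card h).trans (Finset.card_biUnion_le_card_mul _ _ _ fun i hi => ?_)
  rw [← Set.ncard_eq_toFinset_card']
  exact hk i hi

/-! ### Common non-neighbours of an edge -/

section NonNeighbors

variable {V : Type*} [Fintype V] {G : SimpleGraph V} {c : ℕ}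

/-- The common non-neighbours of `a` and `b`. -/
def commonNonNeighbors (G : SimpleGraph V) (a b : V) : Set V :=
  {x | x ≠ a ∧ x ≠ b ∧ ¬ G.Adj a x ∧ ¬ G.Adj b x}

theorem ncard_commonNonNeighbors_le (hG : IsCClosed Gᶜ c) {a b : V} (h : G.Adj a b) :
    (commonNonNeighbors G a b).ncard ≤ c - 1 := by
  have h1 := hG a b h.ne (by simp [h])
  have h2 : Gᶜ.commonNeighbors a b = commonNonNeighbors G a b := by
    ext x
    simp only [SimpleGraph.mem_commonNeighbors, SimpleGraph.compl_adj, commonNonNeighbors,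
      Set.mem_ofPred_eq]
    constructor
    · rintro ⟨⟨h1, h2⟩, h3, h4⟩
      exact ⟨h1.symm, h3.symm, h2, h4⟩
    · rintro ⟨h1, h2, h3, h4⟩
      exact ⟨⟨h1.symm, h3⟩, h2.symm, h4⟩
  rw [h2, ← (Set.toFinite (commonNonNeighbors G a b)).cast_ncard_eq, Nat.cast_lt] at h1
  omega

omit [Fintype V] in
theorem exists_adj_of_maxIndep {X P : Set V} (hP : P ∈ maxIndep G X) {w : V} (hw : w ∈ X)
    (hwP : w ∉ P) : ∃ p ∈ P, G.Adj w p := by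
  by_contra! hcon
  refine hwP (hP.2 (y := insert w P) ⟨Set.insert_subset hw hP.1.1, ?_⟩ (Set.subset_insert _ _)
    (Set.mem_insert _ _))
  rintro u (rfl | hu) v (rfl | hv)
  · exact G.loopless.irrefl _
  · exact hcon v hv
  · exact fun h => hcon u hu h.symm
  · exact hP.1.2 u hu v hv

/-- The summand 1 allows for `X` itself. Any other `P` has a minimal subset `Q` dominating `X \ P`;
each `v ∈ Q` has a private neighbour `u ∉ P`, so the rest of `Q` consists of common non-neighbours
of `u` and `v`. Hence `v` and the trace of `P` on this small set already dominate `X \ P` and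
determine `P`. -/
theorem ncard_maxIndep_le (hG : IsCClosed Gᶜ c) (X : Set V) :
    (maxIndep G X).ncard ≤ 1 + X.ncard ^ 2 * M 0 (c - 1) := by
  classical
  let f : V × V → Set (Set V) := fun e => {P | P ∈ maxIndep G X ∧ G.Adj e.1 e.2 ∧ e.2 ∈ P ∧
    P ∩ commonNonNeighbors G e.1 e.2 ∈ maxIndep G (X ∩ commonNonNeighbors G e.1 e.2) ∧
    ∀ w ∈ X, w ∉ P → ∃ p ∈ insert e.2 (P ∩ commonNonNeighbors G e.1 e.2), G.Adj w p}
  have hf : ∀ e, (f e).ncard ≤ M 0 (c - 1) := by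
    intro e
    by_cases he : G.Adj e.1 e.2
    swap
    · have : f e = ∅ := by
        ext P
        simp only [Set.mem_empty_iff_false, iff_false]
        exact fun h => he h.2.1
      rw [this, Set.ncard_empty]
      exact Nat.zero_le _
    refine le_trans (Set.ncard_le_ncard_of_injOn
      (fun P => P ∩ commonNonNeighbors G e.1 e.2) (fun P hP => hP.2.2.2.1) ?_ (Set.toFinite _))
      (ncard_maxIndep_le_M (X := X ∩ commonNonNeighbors G e.1 e.2) ?_)
    -- A vertex of `P` missing from `Q` would have a neighbour in `e.2` together with the common
    -- trace, hence in the independent set `P`.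
    · have key : ∀ P ∈ f e, ∀ Q ∈ f e,
          P ∩ commonNonNeighbors G e.1 e.2 = Q ∩ commonNonNeighbors G e.1 e.2 → P ⊆ Q := by
        intro P hP Q hQ hPQ w hw
        by_contra hwQ
        obtain ⟨p, hp, hwp⟩ := hQ.2.2.2.2 w (hP.1.1.1 hw) hwQ
        rw [← hPQ] at hp
        have hpP : p ∈ P := by
          rcases hp with rfl | hp
          · exact hP.2.2.1
          · exact hp.1
        exact hP.1.1.2 w hw p hpP hwp
      exact fun P hP Q hQ h => (key P hP Q hQ h).antisymm (key Q hQ P hP h.symm)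
    · exact (Set.ncard_le_ncard Set.inter_subset_right (Set.toFinite _)).trans
        (ncard_commonNonNeighbors_le hG he)
  have hcov : ∀ P ∈ maxIndep G X \ {X}, ∃ e ∈ X.toFinset ×ˢ X.toFinset, P ∈ f e := by
    rintro P ⟨hP, hPX⟩
    obtain ⟨Q, hQP, hQ⟩ := (Set.toFinite
      {Q : Set V | Q ⊆ P ∧ ∀ w ∈ X, w ∉ P → ∃ p ∈ Q, G.Adj w p}).exists_le_minimal
      (a := P) ⟨subset_rfl, fun w hw hwP => exists_adj_of_maxIndep hP hw hwP⟩
    have hQne : Q.Nonempty := by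
      rw [Set.nonempty_iff_ne_empty]
      rintro rfl
      refine hPX (hP.1.1.antisymm fun w hw => ?_)
      by_contra hwP
      obtain ⟨p, hp, -⟩ := hQ.1.2 w hw hwP
      exact hp
    obtain ⟨v, hv⟩ := hQne
    -- If no such `u` existed, `Q \ {v}` would still dominate, contrary to minimality.
    obtain ⟨u, huX, huP, hu⟩ : ∃ u ∈ X, u ∉ P ∧ ∀ p ∈ Q \ {v}, ¬ G.Adj u p := by
      by_contra! hcon
      exact (hQ.2 (y := Q \ {v}) ⟨Set.sdiff_subset.trans hQP, hcon⟩ Set.sdiff_subset hv).2 rfl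
    have huv : G.Adj u v := by
      obtain ⟨p, hp, hup⟩ := hQ.1.2 u huX huP
      by_cases hpv : p = v
      · exact hpv ▸ hup
      · exact absurd hup (hu p ⟨hp, hpv⟩)
    have hQsub : Q ⊆ insert v (P ∩ commonNonNeighbors G u v) := by
      intro p hp
      by_cases hpv : p = v
      · exact Or.inl hpv
      · exact Or.inr ⟨hQP hp, fun h => huP (h ▸ hQP hp), hpv, hu p ⟨hp, hpv⟩,
          hP.1.2 v (hQP hv) p (hQP hp)⟩
    have hblock : ∀ w ∈ X, w ∉ P → ∃ p ∈ insert v (P ∩ commonNonNeighbors G u v), G.Adj w p := by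
      intro w hw hwP
      obtain ⟨p, hp, hwp⟩ := hQ.1.2 w hw hwP
      exact ⟨p, hQsub hp, hwp⟩
    refine ⟨(u, v), ?_, hP, huv, hQP hv, ⟨⟨?_, ?_⟩, ?_⟩, hblock⟩
    · simp [huX, hP.1.1 (hQP hv)]
    · exact Set.inter_subset_inter_left _ hP.1.1
    · exact fun x hx y hy => hP.1.2 x hx.1 y hy.1
    · intro T hT hPT t ht
      refine ⟨?_, (hT.1 ht).2⟩
      by_contra htP
      obtain ⟨p, hp, htp⟩ := hblock t (hT.1 ht).1 htP
      rcases hp with rfl | hp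
      · exact (hT.1 ht).2.2.2.2 htp.symm
      · exact hT.2 t ht p (hPT hp) htp
  have h1 := ncard_le_of_cover _ _ f _ hcov fun e _ => hf e
  rw [Finset.card_product, ← Set.ncard_eq_toFinset_card'] at h1
  have h2 := Set.ncard_le_ncard_sdiff_add_ncard (maxIndep G X) {X} (Set.toFinite _)
  rw [Set.ncard_singleton] at h2
  nlinarith

omit [Fintype V] in
/-- A vertex of a forest outside of the path `b a l x` is not adjacent to both end edges. -/
theorem path_cover {S : Set V} (hS : Acyc G S) {a b l x : V} (ha : a ∈ S) (hb : b ∈ S)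
    (hl : l ∈ S) (hx : x ∈ S) (hab : G.Adj a b) (hal : G.Adj a l) (hlx : G.Adj l x)
    (hbl : b ≠ l) (hbx : b ≠ x) (hax : a ≠ x) :
    b ∈ commonNonNeighbors G l x ∧ x ∈ commonNonNeighbors G a b ∧
      S ⊆ {a, b, l, x} ∪ (commonNonNeighbors G a b ∪ commonNonNeighbors G l x) := by
  have hZS : ({a, b, l, x} : Set V) ⊆ S := by
    rintro y (rfl | rfl | rfl | rfl) <;> assumption
  have ma : a ∈ ({a, b, l, x} : Set V) := by simp
  have mb : b ∈ ({a, b, l, x} : Set V) := by simp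
  have ml : l ∈ ({a, b, l, x} : Set V) := by simp
  have mx : x ∈ ({a, b, l, x} : Set V) := by simp
  have hconn : ∀ y ∈ ({a, b, l, x} : Set V), Conn G {a, b, l, x} a y := by
    rintro y (rfl | rfl | rfl | rfl)
    · exact Conn.refl _
    · exact Conn.single hab ma mb
    · exact Conn.single hal ma ml
    · exact (Conn.single hal ma ml).trans (Conn.single hlx ml mx)
  have hconn' : ∀ y ∈ ({a, b, l, x} : Set V), ∀ z ∈ ({a, b, l, x} : Set V),
      Conn G {a, b, l, x} y z := fun y hy z hz => (hconn y hy).symm.trans (hconn z hz)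
  have nbl : ¬ G.Adj b l := fun h =>
    not_acyc_of_conn (A := {a, l}) (v := b) (by rintro y (rfl | rfl) <;> assumption) hb
      (by simp [hab.ne', hbl]) (by simp) (by simp) hal.ne hab.symm h
      (Conn.single hal (by simp) (by simp)) hS
  have nax : ¬ G.Adj a x := fun h =>
    not_acyc_of_conn (A := {l, x}) (v := a) (by rintro y (rfl | rfl) <;> assumption) ha
      (by simp [hal.ne, hax]) (by simp) (by simp) hlx.ne hal h
      (Conn.single hlx (by simp) (by simp)) hS
  have nbx : ¬ G.Adj b x := fun h =>
    not_acyc_of_conn (A := {a, l, x}) (v := b) (by rintro y (rfl | rfl | rfl) <;> assumption) hb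
      (by simp [hab.ne', hbl, hbx]) (by simp) (by simp) hax hab.symm h
      ((Conn.single hal (by simp) (by simp)).trans (Conn.single hlx (by simp) (by simp))) hS
  refine ⟨⟨hbl, hbx, fun h => nbl h.symm, fun h => nbx h.symm⟩,
    ⟨hax.symm, hbx.symm, nax, nbx⟩, fun r hr => ?_⟩
  by_contra hcon
  simp only [Set.mem_union, not_or] at hcon
  obtain ⟨hrZ, h1, h2⟩ := hcon
  have hrne : r ≠ a ∧ r ≠ b ∧ r ≠ l ∧ r ≠ x := by
    refine ⟨?_, ?_, ?_, ?_⟩ <;> rintro rfl <;> exact hrZ (by simp)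
  have e1 : ∃ p ∈ ({a, b, l, x} : Set V), p ≠ l ∧ p ≠ x ∧ G.Adj r p := by
    by_contra! hh
    exact h1 ⟨hrne.1, hrne.2.1, fun h => hh a ma hal.ne hax h.symm,
      fun h => hh b mb hbl hbx h.symm⟩
  have e2 : ∃ q ∈ ({a, b, l, x} : Set V), (q = l ∨ q = x) ∧ G.Adj r q := by
    by_contra! hh
    exact h2 ⟨hrne.2.2.1, hrne.2.2.2, fun h => hh l ml (Or.inl rfl) h.symm,
      fun h => hh x mx (Or.inr rfl) h.symm⟩
  obtain ⟨p, hp, hpl, hpx, hrp⟩ := e1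
  obtain ⟨q, hq, hq', hrq⟩ := e2
  refine not_acyc_of_conn hZS hr hrZ hp hq ?_ hrp hrq (hconn' p hp q hq) hS
  rintro rfl
  exact hq'.elim hpl hpx

/-- Each of the two sets of common non-neighbours loses one vertex to the path (`x` and `b`
respectively), leaving at most 2(c - 2) vertices besides the contracted path: 2c - 3 in all. -/
theorem ncard_forests_path_le (hc : 2 ≤ c) (hG : IsCClosed Gᶜ c) {a b l x : V}
    (hab : G.Adj a b) (hal : G.Adj a l) (hlx : G.Adj l x)
    (hb : b ∈ commonNonNeighbors G l x) (hx : x ∈ commonNonNeighbors G a b) :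
    (maxForests G {a, b, l, x}
      ({a, b, l, x} ∪ (commonNonNeighbors G a b ∪ commonNonNeighbors G l x))).ncard ≤
      F (2 * c - 3) := by
  have ma : a ∈ ({a, b, l, x} : Set V) := by simp
  have mb : b ∈ ({a, b, l, x} : Set V) := by simp
  have ml : l ∈ ({a, b, l, x} : Set V) := by simp
  have mx : x ∈ ({a, b, l, x} : Set V) := by simp
  have hconn : ∀ y ∈ ({a, b, l, x} : Set V), Conn G {a, b, l, x} a y := by
    rintro y (rfl | rfl | rfl | rfl)
    · exact Conn.refl _
    · exact Conn.single hab ma mb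
    · exact Conn.single hal ma ml
    · exact (Conn.single hal ma ml).trans (Conn.single hlx ml mx)
  refine ncard_maxForests_le_F ⟨a, ma⟩ Set.subset_union_left
    (fun y hy z hz => (hconn y hy).symm.trans (hconn z hz)) ?_
  have h1 : ({a, b, l, x} ∪ (commonNonNeighbors G a b ∪ commonNonNeighbors G l x)) \
      ({a, b, l, x} : Set V) ⊆
      (commonNonNeighbors G a b \ {x}) ∪ (commonNonNeighbors G l x \ {b}) := by
    rintro r ⟨hr | hr | hr, hrZ⟩
    · exact absurd hr hrZ
    · exact Or.inl ⟨hr, fun h => hrZ (by rw [Set.mem_singleton_iff.1 h]; exact mx)⟩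
    · exact Or.inr ⟨hr, fun h => hrZ (by rw [Set.mem_singleton_iff.1 h]; exact mb)⟩
  have h2 := (Set.ncard_le_ncard h1 (Set.toFinite _)).trans (Set.ncard_union_le _ _)
  rw [Set.ncard_sdiff_singleton_of_mem hx, Set.ncard_sdiff_singleton_of_mem hb] at h2
  have h3 := ncard_commonNonNeighbors_le hG hab
  have h4 := ncard_commonNonNeighbors_le hG hlx
  omega

/-- Only `ab` is contracted. Both its ends are common non-neighbours of `l` and `x`, so at most (c -
1) + (c - 3) vertices remain, plus the contracted one. -/
theorem ncard_forests_two_edges_le (hG : IsCClosed Gᶜ c) {a b l x : V}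
    (hab : G.Adj a b) (hlx : G.Adj l x)
    (ha : a ∈ commonNonNeighbors G l x) (hb : b ∈ commonNonNeighbors G l x) :
    (maxForests G {a, b} (commonNonNeighbors G a b ∪ commonNonNeighbors G l x)).ncard ≤
      F (2 * c - 3) := by
  have hconn : ∀ y ∈ ({a, b} : Set V), Conn G {a, b} a y := by
    rintro y (rfl | rfl)
    · exact Conn.refl _
    · exact Conn.single hab (by simp) (by simp)
  have hsub : ({a, b} : Set V) ⊆ commonNonNeighbors G l x := by
    rintro y (rfl | rfl) <;> assumption
  refine ncard_maxForests_le_F ⟨a, by simp⟩ (hsub.trans Set.subset_union_right)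
    (fun y hy z hz => (hconn y hy).symm.trans (hconn z hz)) ?_
  have h1 : (commonNonNeighbors G a b ∪ commonNonNeighbors G l x) \ ({a, b} : Set V) ⊆
      commonNonNeighbors G a b ∪ (commonNonNeighbors G l x \ {a, b}) := by
    rintro r ⟨hr | hr, hrZ⟩
    · exact Or.inl hr
    · exact Or.inr ⟨hr, hrZ⟩
  have h2 := (Set.ncard_le_ncard h1 (Set.toFinite _)).trans (Set.ncard_union_le _ _)
  have h3 := ncard_commonNonNeighbors_le hG hab
  have h4 := ncard_commonNonNeighbors_le hG hlx
  have h5 := Set.ncard_sdiff_add_ncard_of_subset hsub (Set.toFinite _)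
  rw [Set.ncard_pair hab.ne] at h5
  omega

end NonNeighbors

/-! ### Stars, paths and separated edges -/

section MainCount

variable {V : Type*} [Fintype V] {G : SimpleGraph V} {c : ℕ}

theorem one_le_M (N : ℕ) : 1 ≤ M 0 N := by
  have h1 : maxIndep (⊥ : SimpleGraph (Fin 0)) ∅ = {∅} := by
    ext S
    simp only [maxIndep, Set.mem_ofPred_eq, Set.mem_singleton_iff]
    constructor
    · intro h
      exact Set.subset_empty_iff.1 h.1.1
    · rintro rfl
      exact ⟨⟨subset_rfl, fun _ h => h.elim⟩, fun T hT _ => hT.1⟩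
  have h2 := ncard_maxIndep_le_M (G := (⊥ : SimpleGraph (Fin 0))) (X := ∅) (N := N)
    (by rw [Set.ncard_empty]; exact Nat.zero_le _)
  rwa [h1, Set.ncard_singleton] at h2

/-- The maximal forests all of whose edges contain the vertex `a`. -/
def starForests (G : SimpleGraph V) (a : V) : Set (Set V) :=
  {S | S ∈ maximalInducedForests G ∧ a ∈ S ∧ ∀ x ∈ S, ∀ y ∈ S, G.Adj x y → x = a ∨ y = a}

omit [Fintype V] in
theorem mem_of_acyc_insert' {S : Set V} (hS : S ∈ maximalInducedForests G) {v : V}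
    (h : Acyc G (insert v S)) : v ∈ S :=
  hS.2 h (Set.subset_insert v S) (Set.mem_insert v S)

-- When `a` covers all edges, a vertex of the forest that is neither `a` nor adjacent to `a` is
-- isolated in it.
omit [Fintype V] in
theorem eq_of_conn_star {S : Set V} {a x y : V} (hS : S ∈ starForests G a) (hx : x ∈ S)
    (hxa : x ≠ a) (hxN : ¬ G.Adj a x) (h : Conn G S x y) : y = x := by
  refine h.mem_of_closed (B := {x}) rfl ?_
  rintro p hp q hq - hpq
  rw [Set.mem_singleton_iff.1 hp] at hpq
  rcases hS.2.2 x hx q hq hpq with h1 | rfl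
  · exact absurd h1 hxa
  · exact absurd hpq.symm hxN

/-- The trace on the neighbourhood of `a` is a maximal independent set there and determines the
forest. As `a` is not its own neighbour, the count is at most 1 + (n - 1)² M, and the 1 is absorbed
because M ≥ 1. -/
theorem ncard_starForests_le (hG : IsCClosed Gᶜ c) (a : V) :
    (starForests G a).ncard ≤ Fintype.card V ^ 2 * M 0 (c - 1) := by
  have hinj : Set.InjOn (fun S => S ∩ G.neighborSet a) (starForests G a) := by
    have key : ∀ S ∈ starForests G a, ∀ S' ∈ starForests G a,
        S ∩ G.neighborSet a = S' ∩ G.neighborSet a → S ⊆ S' := by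
      intro S hS S' hS' h w hw
      by_contra hwS'
      refine hwS' (mem_of_acyc_insert' hS'.1 ((acyc_insert_iff hwS').2 ⟨hS'.1.1, ?_⟩))
      intro x hx y hy hwx hwy hxy
      have hback : ∀ z ∈ S', (z = a ∨ G.Adj a z) → z ∈ S := by
        rintro z hz (rfl | hz')
        · exact hS.2.1
        · have : z ∈ S' ∩ G.neighborSet a := ⟨hz, hz'⟩
          rw [← h] at this
          exact this.1
      by_cases hx' : x = a ∨ G.Adj a x
      · by_cases hy' : y = a ∨ G.Adj a y
        · have hwa : w ≠ a := fun hwa => hwS' (hwa ▸ hS'.2.1)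
          -- Both neighbours lie in `S` too, where every edge at `w ≠ a` ends in `a`; so they
          -- coincide.
          have h1 := (hS.2.2 w hw x (hback x hx hx') hwx).resolve_left hwa
          have h2 := (hS.2.2 w hw y (hback y hy hy') hwy).resolve_left hwa
          rw [h1, h2]
        · rw [not_or] at hy'
          exact eq_of_conn_star hS' hy hy'.1 hy'.2 hxy.symm
      · rw [not_or] at hx'
        exact (eq_of_conn_star hS' hx hx'.1 hx'.2 hxy).symm
    exact fun S hS S' hS' h => (key S hS S' hS' h).antisymm (key S' hS' S hS h.symm)
  have hmaps : ∀ S ∈ starForests G a, S ∩ G.neighborSet a ∈ maxIndep G (G.neighborSet a) := by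
    intro S hS
    refine ⟨⟨Set.inter_subset_right, ?_⟩, ?_⟩
    · rintro u ⟨hu, hau⟩ v ⟨hv, hav⟩ huv
      rcases hS.2.2 u hu v hv huv with rfl | rfl
      · exact G.loopless.irrefl _ hau
      · exact G.loopless.irrefl _ hav
    · intro T hT hST t ht
      refine ⟨?_, hT.1 ht⟩
      by_contra htS
      refine htS (mem_of_acyc_insert' hS.1 ((acyc_insert_iff htS).2 ⟨hS.1.1, ?_⟩))
      intro x hx y hy htx hty hxy
      have hN : ∀ z ∈ S, G.Adj t z → ¬ G.Adj a z := fun z hz htz haz =>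
        hT.2 t ht z (hST ⟨hz, haz⟩) htz
      by_cases hxa : x = a
      · by_cases hya : y = a
        · rw [hxa, hya]
        · exact eq_of_conn_star hS hy hya (hN y hy hty) hxy.symm
      · exact (eq_of_conn_star hS hx hxa (hN x hx htx) hxy).symm
  have h1 := (Set.ncard_le_ncard_of_injOn _ hmaps hinj (Set.toFinite _)).trans
    (ncard_maxIndep_le hG (G.neighborSet a))
  have h2 : (G.neighborSet a).ncard + 1 ≤ Fintype.card V := by
    have h3 : (insert a (G.neighborSet a)).ncard = (G.neighborSet a).ncard + 1 :=
      Set.ncard_insert_of_notMem (G.loopless.irrefl a) (Set.toFinite _)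
    rw [← h3, ← Nat.card_eq_fintype_card]
    exact Set.ncard_le_card _
  have h4 := one_le_M (c - 1)
  have h5 : ((G.neighborSet a).ncard + 1) ^ 2 ≤ Fintype.card V ^ 2 := Nat.pow_le_pow_left h2 2
  nlinarith [Nat.mul_le_mul_right (M 0 (c - 1)) h5]

omit [Fintype V] in
/-- A forest without an edge-covering vertex contains two disjoint edges. -/
theorem exists_disjoint_edges {S : Set V} (hS : Acyc G S) (hne : S.Nonempty)
    (hstar : ¬ ∃ a ∈ S, ∀ x ∈ S, ∀ y ∈ S, G.Adj x y → x = a ∨ y = a) :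
    ∃ a ∈ S, ∃ b ∈ S, ∃ l ∈ S, ∃ x ∈ S, G.Adj a b ∧ G.Adj l x ∧
      a ≠ l ∧ a ≠ x ∧ b ≠ l ∧ b ≠ x := by
  push Not at hstar
  obtain ⟨s, hs⟩ := hne
  obtain ⟨a, ha, b, hb, hab, -, -⟩ := hstar s hs
  obtain ⟨p, hp, q, hq, hpq, hpa, hqa⟩ := hstar a ha
  obtain ⟨r, hr, t, ht, hrt, hrb, htb⟩ := hstar b hb
  -- Pairwise intersecting edges form a star or a triangle; this excludes the triangle `a b y`.
  have h1 : ∀ y ∈ S, ∀ z ∈ S, G.Adj b y → y ≠ a → G.Adj a z → z ≠ b → y ≠ z := by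
    rintro y hy z hz hby hya haz hzb rfl
    exact not_acyc_of_conn (A := {a, b}) (v := y) (by rintro w (rfl | rfl) <;> assumption) hy
      (by simp [hya, hzb]) (by simp) (by simp) hab.ne haz.symm hby.symm
      (Conn.single hab (by simp) (by simp)) hS
  have h2 : ∀ y ∈ S, ∀ z ∈ S, G.Adj b y → y ≠ a → G.Adj a z → z ≠ b →
      ∃ a ∈ S, ∃ b ∈ S, ∃ l ∈ S, ∃ x ∈ S, G.Adj a b ∧ G.Adj l x ∧
        a ≠ l ∧ a ≠ x ∧ b ≠ l ∧ b ≠ x := fun y hy z hz hby hya haz hzb =>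
    ⟨b, hb, y, hy, a, ha, z, hz, hby, haz, hab.ne', hzb.symm, hya, h1 y hy z hz hby hya haz hzb⟩
  by_cases hpb : p = b
  · subst hpb
    by_cases hra : r = a
    · subst hra
      exact h2 q hq t ht hpq hqa hrt htb
    by_cases hta : t = a
    · subst hta
      exact h2 q hq r hr hpq hqa hrt.symm hrb
    exact ⟨a, ha, p, hb, r, hr, t, ht, hab, hrt, Ne.symm hra, Ne.symm hta, hrb.symm, htb.symm⟩
  by_cases hqb : q = b
  · subst hqb
    by_cases hra : r = a
    · subst hra
      exact h2 p hp t ht hpq.symm hpa hrt htb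
    by_cases hta : t = a
    · subst hta
      exact h2 p hp r hr hpq.symm hpa hrt.symm hrb
    exact ⟨a, ha, q, hb, r, hr, t, ht, hab, hrt, Ne.symm hra, Ne.symm hta, hrb.symm, htb.symm⟩
  exact ⟨a, ha, b, hb, p, hp, q, hq, hab, hpq, hpa.symm, hqa.symm, Ne.symm hpb, Ne.symm hqb⟩

omit [Fintype V] in
/-- Two disjoint edges of a forest span an induced path on four vertices, or belong to one, or no
vertex of the forest is adjacent to both. -/
theorem exists_path_or_separated {S : Set V} {a b l x : V} (ha : a ∈ S)
    (hb : b ∈ S) (hl : l ∈ S) (hx : x ∈ S) (hab : G.Adj a b) (hlx : G.Adj l x)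
    (hal : a ≠ l) (hax : a ≠ x) (hbl : b ≠ l) (hbx : b ≠ x) :
    (∃ a ∈ S, ∃ b ∈ S, ∃ l ∈ S, ∃ x ∈ S, G.Adj a b ∧ G.Adj a l ∧ G.Adj l x ∧
      b ≠ l ∧ b ≠ x ∧ a ≠ x) ∨
    (a ∈ commonNonNeighbors G l x ∧ b ∈ commonNonNeighbors G l x ∧
      S ⊆ commonNonNeighbors G a b ∪ commonNonNeighbors G l x) := by
  -- If `S` contains no path on four vertices at all, then neither an edge between `ab` and `lx` nor
  -- a vertex `r` adjacent to both can exist, since each would create one.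
  by_cases h : ∃ p ∈ S, ∃ p' ∈ S, ∃ q ∈ S, ∃ q' ∈ S, G.Adj p p' ∧ G.Adj p q ∧ G.Adj q q' ∧
      p' ≠ q ∧ p' ≠ q' ∧ p ≠ q'
  · exact Or.inl h
  right
  push Not at h
  have nal : ¬ G.Adj a l := fun e => hax (h a ha b hb l hl x hx hab e hlx hbl hbx)
  have nax : ¬ G.Adj a x := fun e => hal (h a ha b hb x hx l hl hab e hlx.symm hbx hbl)
  have nbl : ¬ G.Adj b l := fun e => hbx (h b hb a ha l hl x hx hab.symm e hlx hal hax)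
  have nbx : ¬ G.Adj b x := fun e => hbl (h b hb a ha x hx l hl hab.symm e hlx.symm hax hal)
  refine ⟨⟨hal, hax, fun e => nal e.symm, fun e => nax e.symm⟩,
    ⟨hbl, hbx, fun e => nbl e.symm, fun e => nbx e.symm⟩, fun r hr => ?_⟩
  by_contra hcon
  simp only [Set.mem_union, not_or] at hcon
  have hra : r ≠ a := by
    rintro rfl
    exact hcon.2 ⟨hal, hax, fun e => nal e.symm, fun e => nax e.symm⟩
  have hrb : r ≠ b := by
    rintro rfl
    exact hcon.2 ⟨hbl, hbx, fun e => nbl e.symm, fun e => nbx e.symm⟩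
  have hrl : r ≠ l := by
    rintro rfl
    exact hcon.1 ⟨hal.symm, hbl.symm, nal, nbl⟩
  have hrx : r ≠ x := by
    rintro rfl
    exact hcon.1 ⟨hax.symm, hbx.symm, nax, nbx⟩
  have e1 : ∃ p ∈ S, ∃ p' ∈ S, G.Adj p p' ∧ G.Adj p r ∧ (p = a ∨ p = b) ∧ p' ≠ r := by
    by_contra! hh
    refine hcon.1 ⟨hra, hrb, fun e => ?_, fun e => ?_⟩
    · exact hrb (hh a ha b hb hab e (Or.inl rfl)).symm
    · exact hra (hh b hb a ha hab.symm e (Or.inr rfl)).symm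
  have e2 : ∃ q ∈ S, G.Adj r q ∧ (q = l ∨ q = x) := by
    by_contra! hh
    exact hcon.2 ⟨hrl, hrx, fun e => (hh l hl e.symm).1 rfl, fun e => (hh x hx e.symm).2 rfl⟩
  obtain ⟨p, hp, p', hp', hpp', hpr, hpab, hp'r⟩ := e1
  obtain ⟨q, hq, hrq, hqlx⟩ := e2
  have hp'ab : p' ≠ q := by
    rintro rfl
    rcases hpab with rfl | rfl <;> rcases hqlx with rfl | rfl
    · exact nal hpp'
    · exact nax hpp'
    · exact nbl hpp'
    · exact nbx hpp'
  have hpq : p ≠ q := by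
    rcases hpab with rfl | rfl <;> rcases hqlx with rfl | rfl <;> assumption
  exact hpq (h p hp p' hp' r hr q hq hpp' hpr hrq hp'r hp'ab)

theorem ncard_maximalInducedForests_le [Nonempty V] (hc : 2 ≤ c) (hG : IsCClosed Gᶜ c) :
    (maximalInducedForests G).ncard ≤ Fintype.card V ^ 3 * M 0 (c - 1)
      + 2 * Fintype.card V ^ 3 * (c - 1) * F (2 * c - 3) := by
  classical
  let A : Set (Set V) := {S | ∃ a, S ∈ starForests G a}
  -- The triple `e` stands for `(a, l, x)`; `b` is kept apart because it ranges over only `c - 1`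
  -- common non-neighbours of `l` and `x`.
  let B : V × V × V → V → Set (Set V) := fun e b => {S | G.Adj e.1 b ∧ G.Adj e.1 e.2.1 ∧
    G.Adj e.2.1 e.2.2 ∧ e.2.2 ∈ commonNonNeighbors G e.1 b ∧
    S ∈ maxForests G {e.1, b, e.2.1, e.2.2} ({e.1, b, e.2.1, e.2.2} ∪
      (commonNonNeighbors G e.1 b ∪ commonNonNeighbors G e.2.1 e.2.2))}
  let D : V × V × V → V → Set (Set V) := fun e b => {S | G.Adj e.1 b ∧ G.Adj e.2.1 e.2.2 ∧
    e.1 ∈ commonNonNeighbors G e.2.1 e.2.2 ∧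
    S ∈ maxForests G {e.1, b} (commonNonNeighbors G e.1 b ∪ commonNonNeighbors G e.2.1 e.2.2)}
  have hB : ∀ e, ∀ b ∈ (commonNonNeighbors G e.2.1 e.2.2).toFinset,
      (B e b).ncard ≤ F (2 * c - 3) := by
    intro e b hb
    rw [Set.mem_toFinset] at hb
    by_cases h : G.Adj e.1 b ∧ G.Adj e.1 e.2.1 ∧ G.Adj e.2.1 e.2.2 ∧
        e.2.2 ∈ commonNonNeighbors G e.1 b
    · refine le_trans (Set.ncard_le_ncard ?_ (Set.toFinite _))
        (ncard_forests_path_le hc hG h.1 h.2.1 h.2.2.1 hb h.2.2.2)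
      exact fun S hS => hS.2.2.2.2
    · have : B e b = ∅ := by
        ext S
        simp only [Set.mem_empty_iff_false, iff_false]
        exact fun hS => h ⟨hS.1, hS.2.1, hS.2.2.1, hS.2.2.2.1⟩
      rw [this, Set.ncard_empty]
      exact Nat.zero_le _
  have hD : ∀ e, ∀ b ∈ (commonNonNeighbors G e.2.1 e.2.2).toFinset,
      (D e b).ncard ≤ F (2 * c - 3) := by
    intro e b hb
    rw [Set.mem_toFinset] at hb
    by_cases h : G.Adj e.1 b ∧ G.Adj e.2.1 e.2.2 ∧ e.1 ∈ commonNonNeighbors G e.2.1 e.2.2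
    · refine le_trans (Set.ncard_le_ncard ?_ (Set.toFinite _))
        (ncard_forests_two_edges_le hG h.1 h.2.1 h.2.2 hb)
      exact fun S hS => hS.2.2.2
    · have : D e b = ∅ := by
        ext S
        simp only [Set.mem_empty_iff_false, iff_false]
        exact fun hS => h ⟨hS.1, hS.2.1, hS.2.2.1⟩
      rw [this, Set.ncard_empty]
      exact Nat.zero_le _
  have count : ∀ E : V × V × V → V → Set (Set V),
      (∀ e, ∀ b ∈ (commonNonNeighbors G e.2.1 e.2.2).toFinset, (E e b).ncard ≤ F (2 * c - 3)) →
      (∀ e b, (E e b).Nonempty → G.Adj e.2.1 e.2.2) →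
      {S | ∃ e, ∃ b ∈ commonNonNeighbors G e.2.1 e.2.2, S ∈ E e b}.ncard ≤
        Fintype.card V ^ 3 * ((c - 1) * F (2 * c - 3)) := by
    intro E hE hEne
    have h := ncard_le_of_cover
      {S | ∃ e, ∃ b ∈ commonNonNeighbors G e.2.1 e.2.2, S ∈ E e b} Finset.univ
      (fun e => {S | ∃ b ∈ commonNonNeighbors G e.2.1 e.2.2, S ∈ E e b})
      ((c - 1) * F (2 * c - 3)) (fun S ⟨e, h⟩ => ⟨e, Finset.mem_univ e, h⟩) ?_
    · rw [Finset.card_univ, Fintype.card_prod, Fintype.card_prod] at h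
      calc _ ≤ _ := h
        _ = _ := by ring
    · intro e _
      by_cases he : G.Adj e.2.1 e.2.2
      · refine (ncard_le_of_cover _ (commonNonNeighbors G e.2.1 e.2.2).toFinset (E e) _ ?_
          (hE e)).trans ?_
        · rintro S ⟨b, hb, hS⟩
          exact ⟨b, Set.mem_toFinset.2 hb, hS⟩
        · refine Nat.mul_le_mul_right _ ?_
          rw [← Set.ncard_eq_toFinset_card']
          exact ncard_commonNonNeighbors_le hG he
      · have : {S | ∃ b ∈ commonNonNeighbors G e.2.1 e.2.2, S ∈ E e b} = ∅ := by
          ext S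
          simp only [Set.mem_empty_iff_false, iff_false]
          rintro ⟨b, -, hS⟩
          exact he (hEne e b ⟨S, hS⟩)
        rw [this, Set.ncard_empty]
        exact Nat.zero_le _
  have hcountB := count B hB fun e b ⟨S, hS⟩ => hS.2.2.1
  have hcountD := count D hD fun e b ⟨S, hS⟩ => hS.2.1
  have hcountA : A.ncard ≤ Fintype.card V * (Fintype.card V ^ 2 * M 0 (c - 1)) :=
    ncard_le_of_cover A Finset.univ (starForests G) _
      (fun S ⟨a, h⟩ => ⟨a, Finset.mem_univ a, h⟩) fun a _ => ncard_starForests_le hG a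
  have hcover : maximalInducedForests G ⊆
      A ∪ ({S | ∃ e, ∃ b ∈ commonNonNeighbors G e.2.1 e.2.2, S ∈ B e b} ∪
        {S | ∃ e, ∃ b ∈ commonNonNeighbors G e.2.1 e.2.2, S ∈ D e b}) := by
    intro S hS
    by_cases hstar : ∃ a ∈ S, ∀ x ∈ S, ∀ y ∈ S, G.Adj x y → x = a ∨ y = a
    · obtain ⟨a, ha, h⟩ := hstar
      exact Or.inl ⟨a, hS, ha, h⟩
    right
    have hmax : ∀ Z X : Set V, Z ⊆ S → S ⊆ X → S ∈ maxForests G Z X := fun Z X hZ hX =>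
      ⟨hZ, ⟨hX, hS.1⟩, fun T hT hST => hS.2 hT.2 hST⟩
    have hne : S.Nonempty := by
      rw [Set.nonempty_iff_ne_empty]
      rintro rfl
      obtain ⟨v⟩ := ‹Nonempty V›
      refine (mem_of_acyc_insert' hS (v := v) ?_ : v ∈ (∅ : Set V))
      exact (acyc_insert_iff (Set.notMem_empty v)).2 ⟨acyc_empty, fun x hx => hx.elim⟩
    obtain ⟨a, ha, b, hb, l, hl, x, hx, hab, hlx, hal, hax, hbl, hbx⟩ :=
      exists_disjoint_edges hS.1 hne hstar
    rcases exists_path_or_separated ha hb hl hx hab hlx hal hax hbl hbx with h | h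
    · left
      obtain ⟨a, ha, b, hb, l, hl, x, hx, hab, hal, hlx, hbl, hbx, hax⟩ := h
      obtain ⟨h1, h2, h4⟩ := path_cover hS.1 ha hb hl hx hab hal hlx hbl hbx hax
      refine ⟨(a, l, x), b, h1, hab, hal, hlx, h2, hmax _ _ ?_ h4⟩
      rintro y (rfl | rfl | rfl | rfl) <;> assumption
    · right
      refine ⟨(a, l, x), b, h.2.1, hab, hlx, h.1, hmax _ _ ?_ h.2.2⟩
      rintro y (rfl | rfl) <;> assumption
  have h1 := Set.ncard_le_ncard hcover (Set.toFinite _)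
  have h2 := h1.trans (Set.ncard_union_le _ _)
  have h3 := Set.ncard_union_le {S | ∃ e, ∃ b ∈ commonNonNeighbors G e.2.1 e.2.2, S ∈ B e b}
    {S | ∃ e, ∃ b ∈ commonNonNeighbors G e.2.1 e.2.2, S ∈ D e b}
  calc (maximalInducedForests G).ncard ≤ Fintype.card V * (Fintype.card V ^ 2 * M 0 (c - 1)) +
        (Fintype.card V ^ 3 * ((c - 1) * F (2 * c - 3)) +
          Fintype.card V ^ 3 * ((c - 1) * F (2 * c - 3))) := by omega
    _ = _ := by ring

end MainCount

/-! ### Numerical estimates -/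

section Bound

/-- The empty set is never maximal when a vertex exists. The saved 1 matters: for `N = 0` the bound
in `M_le_pow` is 1.8638, below 2. -/
theorem M_zero_le (N : ℕ) : M 0 (N + 1) ≤ 2 ^ (N + 1) - 1 := by
  classical
  refine Finset.sup_le fun H _ => ?_
  have h1 : maximalDegreeAtMost 0 H ⊆ {∅}ᶜ := by
    intro S hS h
    rw [Set.mem_singleton_iff] at h
    subst h
    have h2 : ∀ v ∈ ({0} : Set (Fin (N + 1))),
        (H.neighborSet v ∩ {0}).encard ≤ ((0 : ℕ) : ℕ∞) := by
      rw [forall_encard_le_zero_iff]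
      rintro u hu v hv huv
      rw [Set.mem_singleton_iff] at hu hv
      rw [hu, hv] at huv
      exact H.loopless.irrefl _ huv
    exact hS.2 h2 (Set.empty_subset _) (Set.mem_singleton 0)
  refine (Set.ncard_le_ncard h1 (Set.toFinite _)).trans ?_
  rw [Set.ncard_compl, Set.ncard_singleton, Nat.card_eq_fintype_card, Fintype.card_set,
    Fintype.card_fin]

theorem M_le_pow (N : ℕ) :
    (M 0 (N + 1) : ℝ) ≤ ((N : ℝ) + 1) * (1.8638 : ℝ) ^ (2 * N + 1) := by
  have h : ∀ N : ℕ, (2 : ℝ) ^ (N + 1) - 1 ≤ ((N : ℝ) + 1) * (1.8638 : ℝ) ^ (2 * N + 1) := by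
    intro N
    induction N with
    | zero => norm_num
    | succ k ih =>
      have e : (1.8638 : ℝ) ^ (2 * (k + 1) + 1) = 1.8638 ^ 2 * 1.8638 ^ (2 * k + 1) := by
        rw [← pow_add]; congr 1; omega
      have h1 : (1 : ℝ) ≤ (1.8638 : ℝ) ^ (2 * k + 1) := one_le_pow₀ (by norm_num)
      have h2 : (0 : ℝ) ≤ k := Nat.cast_nonneg k
      rw [e, pow_succ]
      push_cast
      nlinarith [mul_nonneg h2 (zero_le_one.trans h1)]
  have h1 : (M 0 (N + 1) : ℝ) ≤ ((2 ^ (N + 1) - 1 : ℕ) : ℝ) := by exact_mod_cast M_zero_le N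
  rw [Nat.cast_sub Nat.one_le_two_pow] at h1
  push_cast at h1
  exact h1.trans (h N)

end Bound

end CClosure

theorem theorem7 {V : Type*} [Fintype V] [Nonempty V] (G : SimpleGraph V) (c : ℕ) (hc : 2 ≤ c)
    (hG : CClosure.IsCClosed Gᶜ c) :
    (CClosure.maximalInducedForests G).ncard ≤
        Fintype.card V ^ 3 * CClosure.M 0 (c - 1)
          + 2 * Fintype.card V ^ 3 * (c - 1) * CClosure.F (2 * c - 3) ∧
      (Fintype.card V : ℝ) ^ 3 * (CClosure.M 0 (c - 1) : ℝ)
          + 2 * (Fintype.card V : ℝ) ^ 3 * ((c : ℝ) - 1) * (CClosure.F (2 * c - 3) : ℝ) ≤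
        3 * (Fintype.card V : ℝ) ^ 3 * ((c : ℝ) - 1) * (1.8638 : ℝ) ^ (2 * c - 3) := by
  refine ⟨CClosure.ncard_maximalInducedForests_le hc hG, ?_⟩
  -- This removes the truncated subtractions: `c - 1` is `k + 1` and `2 * c - 3` is `2 * k + 1`.
  obtain ⟨k, rfl⟩ : ∃ k, c = k + 2 := ⟨c - 2, by omega⟩
  have e1 : k + 2 - 1 = k + 1 := by omega
  have e2 : 2 * (k + 2) - 3 = 2 * k + 1 := by omega
  rw [e1, e2]
  have hM := CClosure.M_le_pow k
  have hF := CClosure.F_le (2 * k + 1)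
  have hn : (0 : ℝ) ≤ (Fintype.card V : ℝ) ^ 3 := by positivity
  have hk : (((k + 2 : ℕ) : ℝ) - 1) = (k : ℝ) + 1 := by push_cast; ring
  rw [hk]
  have hk0 : (0 : ℝ) ≤ (k : ℝ) + 1 := by positivity
  calc (Fintype.card V : ℝ) ^ 3 * (CClosure.M 0 (k + 1) : ℝ)
        + 2 * (Fintype.card V : ℝ) ^ 3 * ((k : ℝ) + 1) * (CClosure.F (2 * k + 1) : ℝ)
      ≤ (Fintype.card V : ℝ) ^ 3 * (((k : ℝ) + 1) * (1.8638 : ℝ) ^ (2 * k + 1))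
        + 2 * (Fintype.card V : ℝ) ^ 3 * ((k : ℝ) + 1) * (1.8638 : ℝ) ^ (2 * k + 1) := by gcongr
    _ = _ := by ring
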